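/- Let $\mathcal H$ be a finite- or countably infinite-dimensional (separable) complex Hilbert space, $\mathcal T(\mathcal H)$ the space of trace class operators on $\mathcal H$. An operation is a completely positive linear map $\Phi:\mathcal T(\mathcal H)\to\mathcal T(\mathcal H)$ with $\mathrm{tr}\,\Phi(\varrho)\le \mathrm{tr}\,\varrho$ for all states $\varrho$ (positive operators of trace one); it is a channel if equality holds for all states. An instrument is a family $(\mathcal I(x,\cdot))_{x\in\Omega}$ of operations, indexed by a finite set $\Omega$, such that $\mathcal I(\Omega,\cdot)$ is a channel, where $\mathcal I(X,\cdot):=\sum_{x\in X}\mathcal I(x,\cdot)$ for $X\subseteq\Omega$. An operation $\Phi$ is part of $\mathcal I$ if $\Phi=\mathcal I(X,\cdot)$ for some $X\subseteq\Omega$. Two operations are compatible if both are parts of one instrument; they are weakly compatible if there are instruments $\mathcal I_1,\mathcal I_2$ (with outcome sets $\Omega_1,\Omega_2$) with $\mathcal I_1(\Omega_1,\cdot)=\mathcal I_2(\Omega_2,\cdot)$ such that the first operation is part of $\mathcal I_1$ and the second is part of $\mathcal I_2$. Let $\Phi_1,\Phi_2$ be operations. (a) $\Phi_1$ and $\Phi_2$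 are compatible if and only if there exist an index set $J\subseteq\mathbb N$, bounded operators $\{K_j\}_{j\in J}$ on $\mathcal H$ and subsets $J_1,J_2\subseteq J$ such that, for all $\varrho\in\mathcal T(\mathcal H)$, $$\Phi_1(\varrho)=\sum_{j\in J_1}K_j\varrho K_j^*,\qquad \Phi_2(\varrho)=\sum_{j\in J_2}K_j\varrho K_j^*,\qquad\text{and}\qquad \sum_{j\in J}K_j^*K_j=\mathbb 1 .$$ (b) $\Phi_1$ and $\Phi_2$ are weakly compatible if and only if there exist an index set $J\subseteq\mathbb N$, bounded operators $\{K_j\}_{j\in J}$, $\{L_j\}_{j\in J}$ on $\mathcal H$ and subsets $J_1,J_2\subseteq J$ such that, for all $\varrho\in\mathcal T(\mathcal H)$, $$\Phi_1(\varrho)=\sum_{j\in J_1}K_j\varrho K_j^*,\qquad \Phi_2(\varrho)=\sum_{j\in J_2}L_j\varrho L_j^*,$$ $$\sum_{j\in J}K_j^*K_j=\sum_{j\in J}L_j^*L_j=\mathbb 1,\qquad \sum_{j\in J}K_j\varrho K_j^*=\sum_{j\in J}L_j\varrho L_j^* .$$ Here $\sum_j K_j\varrho K_j^*$ and $\sum_j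 L_j\varrho L_j^*$ converge unconditionally in trace norm, and $\sum_j K_j^*K_j$, $\sum_j L_j^*L_j$ converge in the strong operator topology. -/

import Mathlib

open scoped ComplexOrder

noncomputable section

namespace QuantumDevice

variable {H : Type*} [NormedAddCommGroup H] [InnerProductSpace ℂ H] [CompleteSpace H]

/-! ### Trace class operators -/

/-- The index set of a fixed orthonormal (Hilbert) basis of `H`. -/
def basisSet (H : Type*) [NormedAddCommGroup H] [InnerProductSpace ℂ H] [CompleteSpace H] :
    Set H :=
  (exists_hilbertBasis ℂ H).choose

/-- A fixed orthonormal (Hilbert) basis of `H`. Nothing below depends on the choice. -/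
def basis (H : Type*) [NormedAddCommGroup H] [InnerProductSpace ℂ H] [CompleteSpace H] :
    HilbertBasis (basisSet H) ℂ H :=
  (exists_hilbertBasis ℂ H).choose_spec.choose

/-- `T` is trace class: `∑ i, ⟨b i, |T| b i⟩ < ∞`, where `|T| = √(T* T)`. -/
def IsTraceClass (T : H →L[ℂ] H) : Prop :=
  Summable fun i => (inner ℂ (basis H i) (CFC.abs T (basis H i))).re

/-- If `‖T x‖ ≤ ‖S x‖` for all `x`, then `T` factors through `S`. -/
lemma exists_factor (S T : H →L[ℂ] H) (h : ∀ x, ‖T x‖ ≤ ‖S x‖) :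
    ∃ U : H →L[ℂ] H, T = U * S := by
  let M := (S : H →ₗ[ℂ] H).range.topologicalClosure
  have hM : ∀ x, S x ∈ M := fun x => Submodule.le_topologicalClosure _ ⟨x, rfl⟩
  let e : H →ₗ[ℂ] M := (S : H →ₗ[ℂ] H).codRestrict M hM
  have hd : DenseRange e := by
    intro y
    have hy : (y : H) ∈ closure ((S : H →ₗ[ℂ] H).range : Set H) := y.2
    rw [Metric.mem_closure_iff] at hy ⊢
    intro ε hε
    obtain ⟨_, ⟨x, rfl⟩, hx⟩ := hy ε hε
    exact ⟨e x, ⟨x, rfl⟩, hx⟩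
  have hn : ∃ C : ℝ, ∀ x, ‖(T : H →ₗ[ℂ] H) x‖ ≤ C * ‖e x‖ :=
    ⟨1, fun x => by rw [one_mul]; exact h x⟩
  have : CompleteSpace M :=
    (Submodule.isClosed_topologicalClosure _).completeSpace_coe
  refine ⟨((T : H →ₗ[ℂ] H).extendOfNorm e).comp M.orthogonalProjectionOnto, ?_⟩
  ext x
  have h1 : M.orthogonalProjectionOnto (S x) = e x :=
    Submodule.orthogonalProjectionOnto_mem_subspace_eq_self (K := M) (e x)
  have h2 := LinearMap.extendOfNorm_eq (f := (T : H →ₗ[ℂ] H)) hd hn x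
  simp only [mul_apply_eq_comp, ContinuousLinearMap.comp_apply, h1]
  exact h2.symm

lemma norm_abs_apply (T : H →L[ℂ] H) (x : H) : ‖CFC.abs T x‖ = ‖T x‖ := by
  have hs : star (CFC.abs T) = CFC.abs T := (CFC.abs_nonneg T).isSelfAdjoint
  have h1 : ∀ S : H →L[ℂ] H, inner ℂ (S x) (S x) = inner ℂ x ((star S * S) x) := by
    intro S
    rw [mul_apply_eq_comp, ContinuousLinearMap.star_eq_adjoint,
      ContinuousLinearMap.adjoint_inner_right]
  have h2 : inner ℂ (CFC.abs T x) (CFC.abs T x) = inner ℂ (T x) (T x) := by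
    rw [h1, h1, hs, CFC.abs_mul_abs]
  rw [inner_self_eq_norm_sq_to_K, inner_self_eq_norm_sq_to_K] at h2
  have h3 : ‖CFC.abs T x‖ ^ 2 = ‖T x‖ ^ 2 := by exact_mod_cast h2
  exact (pow_left_inj₀ (norm_nonneg _) (norm_nonneg _) two_ne_zero).1 h3

lemma exists_eq_mul_abs (T : H →L[ℂ] H) : ∃ U : H →L[ℂ] H, T = U * CFC.abs T :=
  exists_factor _ _ fun x => (norm_abs_apply T x).ge

lemma exists_abs_eq_mul (T : H →L[ℂ] H) : ∃ U : H →L[ℂ] H, CFC.abs T = U * T :=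
  exists_factor _ _ fun x => (norm_abs_apply T x).le

lemma tsum_enorm_inner_sq {ι : Type*} (b : HilbertBasis ι ℂ H) (x : H) :
    ∑' i, ‖inner ℂ (b i) x‖ₑ ^ 2 = ‖x‖ₑ ^ 2 := by
  have h := (b.hasSum_inner_mul_inner x x)
  have h' : HasSum (fun i => ‖inner ℂ (b i) x‖ ^ 2) (‖x‖ ^ 2) := by
    rw [inner_self_eq_norm_sq_to_K] at h
    have h2 : (fun i => inner ℂ x (b i) * inner ℂ (b i) x) =
        fun i => (((‖inner ℂ (b i) x‖ ^ 2 : ℝ)) : ℂ) := by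
      funext i
      rw [← inner_conj_symm x (b i), mul_comm, Complex.mul_conj, Complex.normSq_eq_norm_sq]
    rw [h2] at h
    have h4 : ((‖x‖ : ℂ)) ^ 2 = ((‖x‖ ^ 2 : ℝ) : ℂ) := by push_cast; rfl
    exact Complex.hasSum_ofReal.1 (h4 ▸ h)
  have h3 : ∀ i, ‖inner ℂ (b i) x‖ₑ ^ 2 = ENNReal.ofReal (‖inner ℂ (b i) x‖ ^ 2) := fun i => by
    rw [← ofReal_norm, ENNReal.ofReal_pow (norm_nonneg _)]
  simp_rw [h3]
  rw [← ENNReal.ofReal_tsum_of_nonneg (fun i => by positivity) h'.summable, h'.tsum_eq,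
    ENNReal.ofReal_pow (norm_nonneg _), ofReal_norm]

lemma summable_norm_sq_iff {ι : Type*} (f : ι → H) :
    Summable (fun i => ‖f i‖ ^ 2) ↔ ∑' i, ‖f i‖ₑ ^ 2 ≠ ⊤ := by
  have h : ∀ i, ‖f i‖ₑ ^ 2 = ((‖f i‖₊ ^ 2 : NNReal) : ENNReal) := fun i => by
    rw [ENNReal.coe_pow]; rfl
  simp_rw [h]
  rw [ENNReal.tsum_coe_ne_top_iff_summable, ← NNReal.summable_coe]
  simp

lemma summable_norm_sq_mul {ι : Type*} (b : HilbertBasis ι ℂ H) (R X : H →L[ℂ] H)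
    (hR : star R = R) (h : Summable fun i => ‖R (b i)‖ ^ 2) :
    Summable fun i => ‖R (X (b i))‖ ^ 2 := by
  rw [summable_norm_sq_iff] at h ⊢
  have key : ∑' i, ‖R (X (b i))‖ₑ ^ 2 = ∑' j, ‖(star X) (R (b j))‖ₑ ^ 2 := by
    simp_rw [← tsum_enorm_inner_sq b]
    rw [ENNReal.tsum_comm]
    refine tsum_congr fun j => tsum_congr fun i => ?_
    congr 1
    have : inner ℂ (b j) (R (X (b i))) = inner ℂ ((star X) (R (b j))) (b i) := by
      rw [ContinuousLinearMap.star_eq_adjoint, ContinuousLinearMap.adjoint_inner_left]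
      nth_rewrite 1 [← hR]
      rw [ContinuousLinearMap.star_eq_adjoint, ContinuousLinearMap.adjoint_inner_right]
    rw [this, ← inner_conj_symm, ← ofReal_norm, ← ofReal_norm, RCLike.norm_conj]
  rw [key]
  have hle : ∑' j, ‖(star X) (R (b j))‖ₑ ^ 2 ≤ ‖star X‖ₑ ^ 2 * ∑' j, ‖R (b j)‖ₑ ^ 2 := by
    rw [← ENNReal.tsum_mul_left]
    refine ENNReal.tsum_le_tsum fun j => ?_
    rw [← mul_pow]
    gcongr
    exact ContinuousLinearMap.le_opENorm _ _
  exact ne_top_of_le_ne_top (ENNReal.mul_ne_top (by simp) h) hle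

/-- If `A` is trace class and `X`, `Y` are bounded, then `∑ i, ⟨X b i, A Y b i⟩` converges
absolutely. -/
lemma IsTraceClass.summable_inner {A : H →L[ℂ] H} (hA : IsTraceClass A) (X Y : H →L[ℂ] H) :
    Summable fun i => inner ℂ (X (basis H i)) (A (Y (basis H i))) := by
  obtain ⟨U, hU⟩ := exists_eq_mul_abs A
  set R := CFC.sqrt (CFC.abs A) with hRdef
  have hRR : R * R = CFC.abs A := CFC.sqrt_mul_sqrt_self _ (CFC.abs_nonneg A)
  have hR : star R = R := (CFC.sqrt_nonneg (CFC.abs A)).isSelfAdjoint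
  have hadj : ∀ x y, inner ℂ x (R y) = inner ℂ (R x) y := fun x y => by
    nth_rewrite 1 [← hR]
    rw [ContinuousLinearMap.star_eq_adjoint, ContinuousLinearMap.adjoint_inner_right]
  have hs : Summable fun i => ‖R (basis H i)‖ ^ 2 := by
    refine hA.congr fun i => ?_
    rw [← hRR, mul_apply_eq_comp, hadj, inner_self_eq_norm_sq_to_K]
    norm_cast
  have h1 := summable_norm_sq_mul (basis H) R (star U * X) hR hs
  have h2 := summable_norm_sq_mul (basis H) R Y hR hs
  refine Summable.of_norm_bounded (h1.add h2) fun i => ?_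
  have : inner ℂ (X (basis H i)) (A (Y (basis H i))) =
      inner ℂ (R ((star U * X) (basis H i))) (R (Y (basis H i))) := by
    rw [← hadj, ← mul_apply_eq_comp R R, hRR, mul_apply_eq_comp,
      ContinuousLinearMap.star_eq_adjoint, ContinuousLinearMap.adjoint_inner_left,
      ← mul_apply_eq_comp U, ← hU]
  rw [this]
  refine (norm_inner_le_norm _ _).trans ?_
  nlinarith [sq_nonneg (‖R ((star U * X) (basis H i))‖ - ‖R (Y (basis H i))‖),
    sq_nonneg (‖R ((star U * X) (basis H i))‖), sq_nonneg ‖R (Y (basis H i))‖]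

lemma IsTraceClass.of_summable {T : H →L[ℂ] H}
    (h : ∀ W : H →L[ℂ] H, Summable fun i => inner ℂ (basis H i) (W (T (basis H i)))) :
    IsTraceClass T := by
  obtain ⟨W, hW⟩ := exists_abs_eq_mul T
  refine (Complex.hasSum_re (h W).hasSum).summable.congr fun i => ?_
  rw [hW, mul_apply_eq_comp]

lemma IsTraceClass.summable_inner' {A : H →L[ℂ] H} (hA : IsTraceClass A) (W Y : H →L[ℂ] H) :
    Summable fun i => inner ℂ (basis H i) (W (A (Y (basis H i)))) := by
  refine (hA.summable_inner (star W) Y).congr fun i => ?_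
  rw [ContinuousLinearMap.star_eq_adjoint, ContinuousLinearMap.adjoint_inner_left]

/-- The space of trace class operators on `H`. -/
def traceClass (H : Type*) [NormedAddCommGroup H] [InnerProductSpace ℂ H] [CompleteSpace H] :
    Submodule ℂ (H →L[ℂ] H) where
  carrier := {T | IsTraceClass T}
  zero_mem' := IsTraceClass.of_summable fun W => by simp
  add_mem' {A B} hA hB := IsTraceClass.of_summable fun W => by
    refine ((hA.summable_inner' W 1).add (hB.summable_inner' W 1)).congr fun i => ?_
    simp
  smul_mem' c A hA := IsTraceClass.of_summable fun W => by
    refine ((hA.summable_inner' W 1).mul_left c).congr fun i => ?_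
    simp

/-- The trace `tr T = ∑ i, ⟨b i, T b i⟩` of a trace class operator. -/
def trace (T : traceClass H) : ℂ :=
  ∑' i, inner ℂ (basis H i) ((T : H →L[ℂ] H) (basis H i))

/-- The trace norm `‖T‖₁ = tr |T|` of a trace class operator. -/
def traceNorm (T : traceClass H) : ℝ :=
  ∑' i, (inner ℂ (basis H i) (CFC.abs (T : H →L[ℂ] H) (basis H i))).re

/-- The map `ρ ↦ K ρ K*` on trace class operators. -/
def conj (K : H →L[ℂ] H) : traceClass H →ₗ[ℂ] traceClass H where
  toFun ρ := ⟨K * (ρ : H →L[ℂ] H) * star K, IsTraceClass.of_summable fun W => by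
    refine (IsTraceClass.summable_inner' ρ.2 (W * K) (star K)).congr fun i => ?_
    simp⟩
  map_add' ρ σ := by ext1; simp [mul_add, add_mul]
  map_smul' c ρ := by ext1; simp

/-! ### Operations, channels, instruments (Schrödinger picture) -/

/-- A state: a positive operator of trace one. -/
def IsState (ρ : traceClass H) : Prop :=
  (ρ : H →L[ℂ] H).IsPositive ∧ trace ρ = 1

/-- Complete positivity: for every `n`, applying `Φ` to each entry of an `n × n` block matrix of
trace class operators that is positive as an operator on `Hⁿ` gives a positive block matrix. -/
def IsCompletelyPositive (Φ : traceClass H →ₗ[ℂ] traceClass H) : Prop :=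
  ∀ (n : ℕ) (ρ : Fin n → Fin n → traceClass H),
    (∀ x : Fin n → H, 0 ≤ ∑ i, ∑ j, inner ℂ (x i) ((ρ i j : H →L[ℂ] H) (x j))) →
    ∀ x : Fin n → H, 0 ≤ ∑ i, ∑ j, inner ℂ (x i) ((Φ (ρ i j) : H →L[ℂ] H) (x j))

/-- An operation: completely positive, with `tr Φ(ρ) ≤ tr ρ` for all states `ρ`. -/
def IsOperation (Φ : traceClass H →ₗ[ℂ] traceClass H) : Prop :=
  IsCompletelyPositive Φ ∧ ∀ ρ, IsState ρ → trace (Φ ρ) ≤ trace ρ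

/-- A channel: an operation with `tr Φ(ρ) = tr ρ` for all states `ρ`. -/
def IsChannel (Φ : traceClass H →ₗ[ℂ] traceClass H) : Prop :=
  IsOperation Φ ∧ ∀ ρ, IsState ρ → trace (Φ ρ) = trace ρ

/-- An instrument with a finite outcome set `Ω`. -/
def IsInstrument {Ω : Type} [Fintype Ω] (I : Ω → traceClass H →ₗ[ℂ] traceClass H) : Prop :=
  (∀ x, IsOperation (I x)) ∧ IsChannel (∑ x, I x)

/-- The operation `Φ` is part of the instrument `I`: `Φ = I(X, ·)` for some set `X` of outcomes. -/
def IsPartOf {Ω : Type} (Φ : traceClass H →ₗ[ℂ] traceClass H)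
    (I : Ω → traceClass H →ₗ[ℂ] traceClass H) : Prop :=
  ∃ X : Finset Ω, Φ = ∑ x ∈ X, I x

/-- Two operations are compatible if they are parts of one instrument. -/
def Compatible (Φ₁ Φ₂ : traceClass H →ₗ[ℂ] traceClass H) : Prop :=
  ∃ (Ω : Type) (_ : Fintype Ω) (I : Ω → traceClass H →ₗ[ℂ] traceClass H),
    IsInstrument I ∧ IsPartOf Φ₁ I ∧ IsPartOf Φ₂ I

/-- Two operations are weakly compatible if they are parts of two instruments that have the same
total channel. -/
def WeaklyCompatible (Φ₁ Φ₂ : traceClass H →ₗ[ℂ] traceClass H) : Prop :=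
  ∃ (Ω₁ Ω₂ : Type) (_ : Fintype Ω₁) (_ : Fintype Ω₂)
    (I₁ : Ω₁ → traceClass H →ₗ[ℂ] traceClass H) (I₂ : Ω₂ → traceClass H →ₗ[ℂ] traceClass H),
    IsInstrument I₁ ∧ IsInstrument I₂ ∧ IsPartOf Φ₁ I₁ ∧ IsPartOf Φ₂ I₂ ∧
      ∑ x, I₁ x = ∑ x, I₂ x

/-! ### Kraus families -/

/-- `Φ(ρ) = ∑_{j ∈ J} K_j ρ K_j*` for every trace class operator `ρ`, the sum converging
(unconditionally) in trace norm. -/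
def HasKrausSum (K : ℕ → H →L[ℂ] H) (J : Set ℕ)
    (Φ : traceClass H →ₗ[ℂ] traceClass H) : Prop :=
  ∀ ρ, Filter.Tendsto (fun s : Finset J => traceNorm (Φ ρ - ∑ j ∈ s, conj (K j) ρ))
    Filter.atTop (nhds 0)

/-- `∑_{j ∈ J} K_j* K_j = 1` in the strong operator topology. -/
def IsComplete (K : ℕ → H →L[ℂ] H) (J : Set ℕ) : Prop :=
  ∀ ψ : H, HasSum (fun j : J => (star (K j) * K j) ψ) ψ

end QuantumDevice

end

/-!
Both equivalences rest on the Kraus representation: on a separable Hilbert space an operation is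
the same thing as a map `ρ ↦ ∑ j, K_j ρ K_j*` with `∑ j, K_j* K_j ≤ 1`, and it is a channel exactly
if `∑ j, K_j* K_j = 1`. Given this, the operations of an instrument have Kraus families that
combine into one complete family (`IsInstrument.exists_kraus`), and conversely a partition of the
index set of a complete family into finitely many pieces gives an instrument
(`IsComplete.exists_instrument`). For two subsets `J₁`, `J₂` of one index set, the relevant
partition records membership in `J₁` and in `J₂`; for weak compatibility each family is partitioned
separately, and the common channel makes the two instruments fit together.

Existence of Kraus families (`IsOperation.exists_kraus`). Complete positivity says that
`(u, v) ↦ Φ(|u⟩⟨v|)` is a positive semidefinite operator-valued kernel on `H`. In its reproducing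
kernel Hilbert space there are vectors `F u x`, linear in `x` and conjugate linear in `u`, with
`⟨F u x, F v y⟩ = ⟨x, Φ(|u⟩⟨v|) y⟩`. The space is separable, so Parseval's identity in a countable
orthonormal basis `g` yields the Kraus operators `K_j u = (F u)* g_j` on rank one operators. The
general case follows since operations do not increase the trace of positive operators and every
positive trace class `ρ` is a sum `∑ n, |√ρ b_n⟩⟨√ρ b_n|` (`IsOperation.ext`).

Convergence. For positive `ρ` the sum `∑ j, K_j ρ K_j*` has positive terms, so its remainders are
positive and their trace norm is their trace, which tends to zero by Tonelli's theorem
(`remainder_of_hasSum`). Since positive operators span the trace class (`traceClass_induction`),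
convergence in the weak operator topology and unconditional convergence in trace norm are the same
for Kraus sums (`hasKrausSum_iff`).
-/

open scoped ComplexOrder

set_option linter.unusedSectionVars false

noncomputable section

namespace QuantumDevice

variable {H : Type*} [NormedAddCommGroup H] [InnerProductSpace ℂ H] [CompleteSpace H]

/-! ### Positive operators and their trace -/

lemma isPositive_iff_inner_nonneg (T : H →L[ℂ] H) :
    T.IsPositive ↔ ∀ x, 0 ≤ inner ℂ x (T x) := by
  refine ⟨fun h x => h.inner_nonneg_right x, fun h => ?_⟩
  rw [ContinuousLinearMap.isPositive_iff_complex]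
  intro x
  have hx := Complex.nonneg_iff.1 (h x)
  have hr : inner ℂ (T x) x = (((inner ℂ x (T x)).re : ℝ) : ℂ) := by
    rw [← inner_conj_symm]
    exact Complex.ext rfl (by rw [Complex.conj_im, ← hx.2]; simp)
  rw [hr]
  exact ⟨by simp, by simpa using hx.1⟩

lemma inner_eq_ofReal {T : H →L[ℂ] H} (hT : T.IsPositive) (x : H) :
    inner ℂ x (T x) = (((inner ℂ x (T x)).re : ℝ) : ℂ) := by
  have hx := Complex.nonneg_iff.1 (hT.inner_nonneg_right x)
  apply Complex.ext <;> simp [← hx.2]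

lemma re_inner_nonneg {T : H →L[ℂ] H} (hT : T.IsPositive) (x : H) :
    0 ≤ (inner ℂ x (T x)).re :=
  (Complex.nonneg_iff.1 (hT.inner_nonneg_right x)).1

lemma abs_of_isPositive {T : H →L[ℂ] H} (hT : T.IsPositive) : CFC.abs T = T :=
  CFC.abs_of_nonneg T ((ContinuousLinearMap.nonneg_iff_isPositive T).2 hT)

lemma isPositive_abs (T : H →L[ℂ] H) : (CFC.abs T).IsPositive :=
  (ContinuousLinearMap.nonneg_iff_isPositive _).1 (CFC.abs_nonneg T)

/-- The trace of a positive operator, as an extended nonnegative real; it is finite exactly for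
trace class operators. Only meaningful for positive operators. -/
def etrace (T : H →L[ℂ] H) : ENNReal :=
  ∑' i, ENNReal.ofReal (inner ℂ (basis H i) (T (basis H i))).re

lemma summable_iff_etrace_ne_top {T : H →L[ℂ] H} (hT : T.IsPositive) :
    Summable (fun i => (inner ℂ (basis H i) (T (basis H i))).re) ↔ etrace T ≠ ⊤ := by
  refine ⟨fun h => h.tsum_ofReal_ne_top, fun h => ?_⟩
  refine (ENNReal.summable_toReal h).congr fun i => ?_
  rw [ENNReal.toReal_ofReal (re_inner_nonneg hT _)]

lemma isTraceClass_iff_etrace_ne_top {T : H →L[ℂ] H} (hT : T.IsPositive) :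
    IsTraceClass T ↔ etrace T ≠ ⊤ := by
  rw [← summable_iff_etrace_ne_top hT, IsTraceClass, abs_of_isPositive hT]

lemma etrace_abs_ne_top (ρ : traceClass H) : etrace (CFC.abs (ρ : H →L[ℂ] H)) ≠ ⊤ :=
  (summable_iff_etrace_ne_top (isPositive_abs _)).1 ρ.2

lemma traceNorm_eq (ρ : traceClass H) :
    traceNorm ρ = (etrace (CFC.abs (ρ : H →L[ℂ] H))).toReal := by
  rw [traceNorm, etrace, ENNReal.tsum_toReal_eq (by simp)]
  exact tsum_congr fun i => (ENNReal.toReal_ofReal (re_inner_nonneg (isPositive_abs _) _)).symm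

lemma traceNorm_of_isPositive {ρ : traceClass H} (hρ : (ρ : H →L[ℂ] H).IsPositive) :
    traceNorm ρ = (etrace (ρ : H →L[ℂ] H)).toReal := by
  rw [traceNorm_eq, abs_of_isPositive hρ]

lemma etrace_ne_top {ρ : traceClass H} (hρ : (ρ : H →L[ℂ] H).IsPositive) :
    etrace (ρ : H →L[ℂ] H) ≠ ⊤ :=
  (isTraceClass_iff_etrace_ne_top hρ).1 ρ.2

lemma ofReal_traceNorm {ρ : traceClass H} (hρ : (ρ : H →L[ℂ] H).IsPositive) :
    ENNReal.ofReal (traceNorm ρ) = etrace (ρ : H →L[ℂ] H) := by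
  rw [traceNorm_of_isPositive hρ, ENNReal.ofReal_toReal (etrace_ne_top hρ)]

lemma traceNorm_nonneg (ρ : traceClass H) : 0 ≤ traceNorm ρ := by
  rw [traceNorm_eq]; exact ENNReal.toReal_nonneg

lemma trace_of_isPositive {ρ : traceClass H} (hρ : (ρ : H →L[ℂ] H).IsPositive) :
    trace ρ = ((traceNorm ρ : ℝ) : ℂ) := by
  rw [trace, traceNorm, abs_of_isPositive hρ, Complex.ofReal_tsum]
  exact tsum_congr fun i => inner_eq_ofReal hρ _

lemma trace_smul (c : ℂ) (ρ : traceClass H) : trace (c • ρ) = c * trace ρ := by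
  simp only [trace, Submodule.coe_smul, FunLike.coe_smul, Pi.smul_apply, inner_smul_right]
  exact tsum_mul_left

/-- A positive operator is `R²` for a self-adjoint `R`. -/
lemma exists_sqrt {T : H →L[ℂ] H} (hT : T.IsPositive) :
    ∃ R : H →L[ℂ] H, R * R = T ∧ ∀ x y, inner ℂ x (R y) = inner ℂ (R x) y := by
  have hT' := (ContinuousLinearMap.nonneg_iff_isPositive T).2 hT
  refine ⟨CFC.sqrt T, CFC.sqrt_mul_sqrt_self T hT', fun x y => ?_⟩
  have hR : star (CFC.sqrt T) = CFC.sqrt T := (CFC.sqrt_nonneg T).isSelfAdjoint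
  nth_rewrite 1 [← hR]
  rw [ContinuousLinearMap.star_eq_adjoint, ContinuousLinearMap.adjoint_inner_right]

lemma enorm_inner_symm (x y : H) : ‖inner ℂ x y‖ₑ = ‖inner ℂ y x‖ₑ := by
  rw [← ofReal_norm, ← ofReal_norm, norm_inner_symm]

/-- A positive operator is `∑ n, |u n⟩⟨u n|` in the sense of quadratic forms, where
`u n = √T (b n)`. -/
lemma exists_vectors {T : H →L[ℂ] H} (hT : T.IsPositive) :
    ∃ u : basisSet H → H,
      ∀ x, ∑' n, ‖inner ℂ x (u n)‖ₑ ^ 2 = ENNReal.ofReal (inner ℂ x (T x)).re := by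
  obtain ⟨R, hRR, hR⟩ := exists_sqrt hT
  refine ⟨fun n => R (basis H n), fun x => ?_⟩
  have h1 : ∀ x, ENNReal.ofReal (inner ℂ x (T x)).re = ‖R x‖ₑ ^ 2 := fun x => by
    rw [← hRR, mul_apply_eq_comp, hR, inner_self_eq_norm_sq_to_K, ← ofReal_norm,
      ← ENNReal.ofReal_pow (norm_nonneg _)]
    norm_cast
  rw [h1, ← tsum_enorm_inner_sq (basis H)]
  refine tsum_congr fun i => ?_
  rw [hR, enorm_inner_symm]

/-- If `T = ∑ n, |u n⟩⟨u n|` in the sense of quadratic forms, then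
`tr (K T K*) = ∑ n, ‖K (u n)‖²`. -/
lemma etrace_conj_eq {ι : Type*} {T : H →L[ℂ] H} {u : ι → H}
    (hu : ∀ x, ∑' n, ‖inner ℂ x (u n)‖ₑ ^ 2 = ENNReal.ofReal (inner ℂ x (T x)).re)
    (K : H →L[ℂ] H) : etrace (K * T * star K) = ∑' n, ‖K (u n)‖ₑ ^ 2 := by
  have h : ∀ n, ‖K (u n)‖ₑ ^ 2 = ∑' i, ‖inner ℂ (basis H i) (K (u n))‖ₑ ^ 2 := fun n =>
    (tsum_enorm_inner_sq _ _).symm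
  simp_rw [h]
  rw [ENNReal.tsum_comm, etrace]
  refine tsum_congr fun i => ?_
  have h2 : inner ℂ (basis H i) ((K * T * star K) (basis H i)) =
      inner ℂ (star K (basis H i)) (T (star K (basis H i))) := by
    rw [mul_apply_eq_comp, mul_apply_eq_comp, ContinuousLinearMap.star_eq_adjoint,
      ContinuousLinearMap.adjoint_inner_left]
  rw [h2, ← hu]
  refine tsum_congr fun n => ?_
  rw [ContinuousLinearMap.star_eq_adjoint, ContinuousLinearMap.adjoint_inner_left]

lemma etrace_eq {ι : Type*} {T : H →L[ℂ] H} {u : ι → H}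
    (hu : ∀ x, ∑' n, ‖inner ℂ x (u n)‖ₑ ^ 2 = ENNReal.ofReal (inner ℂ x (T x)).re) :
    etrace T = ∑' n, ‖u n‖ₑ ^ 2 := by
  simpa using etrace_conj_eq hu 1

/-- The trace of positive operators is countably additive for weakly convergent sums. -/
lemma etrace_eq_tsum {ι : Type*} {T : H →L[ℂ] H} {S : ι → H →L[ℂ] H}
    (hS : ∀ j, (S j).IsPositive)
    (h : ∀ x, HasSum (fun j => inner ℂ x (S j x)) (inner ℂ x (T x))) :
    etrace T = ∑' j, etrace (S j) := by
  simp only [etrace]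
  rw [ENNReal.tsum_comm]
  refine tsum_congr fun i => ?_
  have h1 := Complex.hasSum_re (h (basis H i))
  rw [← h1.tsum_eq, ENNReal.ofReal_tsum_of_nonneg (fun j => re_inner_nonneg (hS j) _) h1.summable]

lemma isPositive_of_hasSum {ι : Type*} {T : H →L[ℂ] H} {S : ι → H →L[ℂ] H}
    (hS : ∀ j, (S j).IsPositive)
    (h : ∀ x, HasSum (fun j => inner ℂ x (S j x)) (inner ℂ x (T x))) : T.IsPositive := by
  rw [isPositive_iff_inner_nonneg]
  exact fun x => (h x).nonneg fun j => (hS j).inner_nonneg_right x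

/-! ### The trace norm -/

/-- If `‖T x‖ ≤ ‖S x‖` for all `x`, then `T` factors through `S` by a contraction. -/
lemma exists_contraction_factor (S T : H →L[ℂ] H) (h : ∀ x, ‖T x‖ ≤ ‖S x‖) :
    ∃ U : H →L[ℂ] H, T = U * S ∧ ‖U‖ ≤ 1 := by
  obtain ⟨U, hU⟩ := exists_factor S T h
  let M := (S : H →ₗ[ℂ] H).range.topologicalClosure
  have : CompleteSpace M := (Submodule.isClosed_topologicalClosure _).completeSpace_coe
  have hM : ∀ x, S x ∈ M := fun x => Submodule.le_topologicalClosure _ ⟨x, rfl⟩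
  have hle : ∀ y ∈ M, ‖U y‖ ≤ ‖y‖ := by
    intro y hy
    have hc : IsClosed {y | ‖U y‖ ≤ ‖y‖} :=
      isClosed_le (U.continuous.norm) continuous_norm
    refine closure_minimal ?_ hc hy
    rintro _ ⟨x, rfl⟩
    have := h x
    rw [hU] at this
    exact this
  refine ⟨U * M.starProjection, ?_, ?_⟩
  · ext x
    rw [mul_apply_eq_comp, mul_apply_eq_comp, Submodule.starProjection_eq_self_iff.2 (hM x)]
    rw [← mul_apply_eq_comp, ← hU]
  · refine ContinuousLinearMap.opNorm_le_bound _ zero_le_one fun x => ?_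
    rw [mul_apply_eq_comp, one_mul]
    refine (hle _ (Submodule.starProjection_apply_mem _ _)).trans ?_
    exact Submodule.norm_starProjection_apply_le _ _

/-- `Re tr (W ρ) ≤ ‖ρ‖₁` for a contraction `W`. -/
lemma re_tsum_inner_le_traceNorm (ρ : traceClass H) (W : H →L[ℂ] H) (hW : ‖W‖ ≤ 1) :
    (∑' i, inner ℂ (basis H i) (W ((ρ : H →L[ℂ] H) (basis H i)))).re ≤ traceNorm ρ := by
  obtain ⟨U, hU, hU1⟩ := exists_contraction_factor (CFC.abs (ρ : H →L[ℂ] H)) (ρ : H →L[ℂ] H)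
    fun x => (norm_abs_apply _ x).ge
  obtain ⟨R, hRR, hR⟩ := exists_sqrt (isPositive_abs (ρ : H →L[ℂ] H))
  have hRs : star R = R := by
    rw [ContinuousLinearMap.star_eq_adjoint]
    refine ContinuousLinearMap.ext fun y => ext_inner_left ℂ fun x => ?_
    rw [ContinuousLinearMap.adjoint_inner_right, hR]
  have habs : ∀ x, (inner ℂ x (CFC.abs (ρ : H →L[ℂ] H) x)).re = ‖R x‖ ^ 2 := fun x => by
    rw [← hRR, mul_apply_eq_comp, hR, inner_self_eq_norm_sq_to_K]
    norm_cast
  have hs : Summable fun i => ‖R (basis H i)‖ ^ 2 := by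
    have h := ρ.2
    change Summable _ at h
    simpa only [habs] using h
  have hV1 : ‖star (W * U)‖ ≤ 1 := by
    rw [norm_star]
    exact (norm_mul_le _ _).trans (mul_le_one₀ hW (norm_nonneg _) hU1)
  set V := star (W * U) with hV
  have hs2 := summable_norm_sq_mul (basis H) R V hRs hs
  -- The Hilbert-Schmidt norm does not increase under multiplication by a contraction.
  have hle : ∑' i, ‖R (V (basis H i))‖ ^ 2 ≤ ∑' i, ‖R (basis H i)‖ ^ 2 := by
    have e1 : ∀ f : basisSet H → H, (Summable fun i => ‖f i‖ ^ 2) →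
        ENNReal.ofReal (∑' i, ‖f i‖ ^ 2) = ∑' i, ‖f i‖ₑ ^ 2 := fun f hf => by
      rw [ENNReal.ofReal_tsum_of_nonneg (fun i => by positivity) hf]
      exact tsum_congr fun i => by rw [ENNReal.ofReal_pow (norm_nonneg _), ofReal_norm]
    rw [← ENNReal.ofReal_le_ofReal_iff (tsum_nonneg fun i => by positivity), e1 _ hs2, e1 _ hs]
    have key : ∑' i, ‖R (V (basis H i))‖ₑ ^ 2 = ∑' j, ‖(star V) (R (basis H j))‖ₑ ^ 2 := by
      simp_rw [← tsum_enorm_inner_sq (basis H)]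
      rw [ENNReal.tsum_comm]
      refine tsum_congr fun j => tsum_congr fun i => ?_
      rw [hR, enorm_inner_symm, ContinuousLinearMap.star_eq_adjoint,
        ContinuousLinearMap.adjoint_inner_right, enorm_inner_symm, enorm_inner_symm]
    rw [key]
    refine ENNReal.tsum_le_tsum fun j => ?_
    gcongr
    rw [← ofReal_norm, ← ofReal_norm]
    refine ENNReal.ofReal_le_ofReal (((star V).le_opNorm _).trans ?_)
    rw [norm_star]
    exact mul_le_of_le_one_left (norm_nonneg _) hV1
  have hin : ∀ i, inner ℂ (basis H i) (W ((ρ : H →L[ℂ] H) (basis H i))) =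
      inner ℂ (R (V (basis H i))) (R (basis H i)) := fun i => by
    rw [← hR, ← mul_apply_eq_comp R R, hRR, hV, ContinuousLinearMap.star_eq_adjoint,
      ContinuousLinearMap.adjoint_inner_left, mul_apply_eq_comp, ← mul_apply_eq_comp U, ← hU]
  have hsum := Complex.hasSum_re (IsTraceClass.summable_inner' ρ.2 W 1).hasSum
  simp only [one_apply_eq_self] at hsum
  rw [← hsum.tsum_eq]
  have hb : ∀ i, (inner ℂ (basis H i) (W ((ρ : H →L[ℂ] H) (basis H i)))).re ≤
      (‖R (V (basis H i))‖ ^ 2 + ‖R (basis H i)‖ ^ 2) / 2 := fun i => by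
    rw [hin]
    refine (Complex.re_le_norm _).trans ((norm_inner_le_norm _ _).trans ?_)
    nlinarith [sq_nonneg (‖R (V (basis H i))‖ - ‖R (basis H i)‖)]
  refine (hsum.summable.tsum_le_tsum hb ((hs2.add hs).div_const 2)).trans ?_
  rw [tsum_div_const, hs2.tsum_add hs, traceNorm]
  simp only [habs]
  linarith

/-- Dual description of the trace norm: `‖ρ‖₁ = Re tr (W ρ)` for some contraction `W`. -/
lemma exists_traceNorm_eq (ρ : traceClass H) : ∃ W : H →L[ℂ] H, ‖W‖ ≤ 1 ∧
    traceNorm ρ = (∑' i, inner ℂ (basis H i) (W ((ρ : H →L[ℂ] H) (basis H i)))).re := by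
  obtain ⟨W, hW, hW1⟩ := exists_contraction_factor (ρ : H →L[ℂ] H) (CFC.abs (ρ : H →L[ℂ] H))
    fun x => (norm_abs_apply _ x).le
  refine ⟨W, hW1, ?_⟩
  have hsum := Complex.hasSum_re (IsTraceClass.summable_inner' ρ.2 W 1).hasSum
  simp only [one_apply_eq_self] at hsum
  rw [← hsum.tsum_eq, traceNorm]
  refine tsum_congr fun i => ?_
  rw [hW, mul_apply_eq_comp]

lemma traceNorm_add_le (ρ σ : traceClass H) : traceNorm (ρ + σ) ≤ traceNorm ρ + traceNorm σ := by
  obtain ⟨W, hW, h⟩ := exists_traceNorm_eq (ρ + σ)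
  have h1 := IsTraceClass.summable_inner' ρ.2 W 1
  have h2 := IsTraceClass.summable_inner' σ.2 W 1
  simp only [one_apply_eq_self] at h1 h2
  rw [h]
  simp only [Submodule.coe_add, FunLike.coe_add, Pi.add_apply, map_add, inner_add_right]
  rw [h1.tsum_add h2, Complex.add_re]
  exact add_le_add (re_tsum_inner_le_traceNorm ρ W hW) (re_tsum_inner_le_traceNorm σ W hW)

lemma traceNorm_smul (c : ℂ) (ρ : traceClass H) : traceNorm (c • ρ) = ‖c‖ * traceNorm ρ := by
  have h : CFC.abs ((c • ρ : traceClass H) : H →L[ℂ] H) = ‖c‖ • CFC.abs (ρ : H →L[ℂ] H) :=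
    CFC.abs_smul c _
  simp only [traceNorm, h, FunLike.coe_smul, Pi.smul_apply]
  rw [← tsum_mul_left]
  refine tsum_congr fun i => ?_
  rw [← Complex.coe_smul, inner_smul_right, Complex.re_ofReal_mul]

/-- The operator norm is at most the trace norm. -/
lemma norm_le_traceNorm (ρ : traceClass H) : ‖(ρ : H →L[ℂ] H)‖ ≤ traceNorm ρ := by
  obtain ⟨R, hRR, hR⟩ := exists_sqrt (isPositive_abs (ρ : H →L[ℂ] H))
  have habs : ∀ x, (inner ℂ x (CFC.abs (ρ : H →L[ℂ] H) x)).re = ‖R x‖ ^ 2 := fun x => by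
    rw [← hRR, mul_apply_eq_comp, hR, inner_self_eq_norm_sq_to_K]
    norm_cast
  -- `‖R‖` is at most the Hilbert-Schmidt norm of `R = √|ρ|`.
  have h1 : ∀ x, ‖R x‖ ≤ √(traceNorm ρ) * ‖x‖ := fun x => by
    have h : ‖R x‖ₑ ^ 2 ≤ ENNReal.ofReal (traceNorm ρ) * ‖x‖ₑ ^ 2 := by
      rw [← tsum_enorm_inner_sq (basis H), traceNorm_eq,
        ENNReal.ofReal_toReal (etrace_abs_ne_top ρ), etrace, ← ENNReal.tsum_mul_right]
      refine ENNReal.tsum_le_tsum fun i => ?_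
      rw [habs, hR, ENNReal.ofReal_pow (norm_nonneg _), ofReal_norm, ← mul_pow]
      gcongr
      simp only [← ofReal_norm, ← ENNReal.ofReal_mul (norm_nonneg (R _))]
      exact ENNReal.ofReal_le_ofReal (norm_inner_le_norm _ _)
    rw [← ofReal_norm, ← ofReal_norm, ← ENNReal.ofReal_pow (norm_nonneg _),
      ← ENNReal.ofReal_pow (norm_nonneg _), ← ENNReal.ofReal_mul (traceNorm_nonneg _),
      ENNReal.ofReal_le_ofReal_iff (mul_nonneg (traceNorm_nonneg _) (by positivity))] at h
    refine abs_le_of_sq_le_sq' ?_ (by positivity) |>.2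
    rwa [mul_pow, Real.sq_sqrt (traceNorm_nonneg _)]
  have h2 : ‖R‖ ≤ √(traceNorm ρ) := R.opNorm_le_bound (Real.sqrt_nonneg _) h1
  rw [← CFC.norm_abs (a := (ρ : H →L[ℂ] H)), ← hRR]
  calc ‖R * R‖ ≤ ‖R‖ * ‖R‖ := norm_mul_le _ _
    _ ≤ √(traceNorm ρ) * √(traceNorm ρ) := by gcongr
    _ = traceNorm ρ := Real.mul_self_sqrt (traceNorm_nonneg _)

lemma conj_coe (K : H →L[ℂ] H) (ρ : traceClass H) :
    (conj K ρ : H →L[ℂ] H) = K * (ρ : H →L[ℂ] H) * star K := rfl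

lemma inner_conj_apply (K : H →L[ℂ] H) (ρ : traceClass H) (x y : H) :
    inner ℂ x ((conj K ρ : H →L[ℂ] H) y) =
      inner ℂ (star K x) ((ρ : H →L[ℂ] H) (star K y)) := by
  rw [conj_coe, mul_apply_eq_comp, mul_apply_eq_comp, ContinuousLinearMap.star_eq_adjoint,
    ContinuousLinearMap.adjoint_inner_left]

lemma isPositive_conj (K : H →L[ℂ] H) {ρ : traceClass H} (hρ : (ρ : H →L[ℂ] H).IsPositive) :
    (conj K ρ : H →L[ℂ] H).IsPositive := by
  rw [isPositive_iff_inner_nonneg]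
  intro x
  rw [inner_conj_apply]
  exact hρ.inner_nonneg_right _

/-- Positive trace class operators span the trace class: with the polar decomposition `ρ = U |ρ|`,
`4 ρ = ∑ k, i^k V_k |ρ| V_k*` where `V_k = 1 + (-i)^k U`. -/
lemma traceClass_induction {p : traceClass H → Prop}
    (pos : ∀ ρ : traceClass H, (ρ : H →L[ℂ] H).IsPositive → p ρ)
    (add : ∀ ρ σ, p ρ → p σ → p (ρ + σ)) (smul : ∀ (c : ℂ) (ρ), p ρ → p (c • ρ))
    (ρ : traceClass H) : p ρ := by
  obtain ⟨U, hU⟩ := exists_eq_mul_abs (ρ : H →L[ℂ] H)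
  have htc : IsTraceClass (CFC.abs (ρ : H →L[ℂ] H)) :=
    (isTraceClass_iff_etrace_ne_top (isPositive_abs _)).2 (etrace_abs_ne_top ρ)
  let A : traceClass H := ⟨CFC.abs (ρ : H →L[ℂ] H), htc⟩
  have hA : ∀ V, p (conj V A) := fun V => pos _ (isPositive_conj V (isPositive_abs _))
  have key : ρ = (4 : ℂ)⁻¹ • (((conj (1 + U) A + Complex.I • conj (1 + (-Complex.I) • U) A)
      + (-1 : ℂ) • conj (1 + (-1 : ℂ) • U) A)
      + (-Complex.I) • conj (1 + Complex.I • U) A) := by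
    apply Subtype.ext
    simp only [Submodule.coe_smul, Submodule.coe_add, conj_coe, A, star_add, star_one, star_smul]
    nth_rewrite 1 [hU]
    set B := CFC.abs (ρ : H →L[ℂ] H)
    simp only [mul_add, add_mul, one_mul, mul_one, smul_mul_assoc, mul_smul_comm, smul_add,
      smul_smul]
    simp only [Complex.star_def, map_neg, Complex.conj_I, map_one]
    match_scalars <;> simp; ring_nf
  rw [key]
  exact smul _ _ (add _ _ (add _ _ (add _ _ (hA _) (smul _ _ (hA _))) (smul _ _ (hA _)))
    (smul _ _ (hA _)))

/-! ### Weakly convergent sums of positive trace class operators -/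

lemma hasSum_of_tsum_ofReal {ι : Type*} {f : ι → ℝ} {r : ℝ} (hf : ∀ i, 0 ≤ f i) (hr : 0 ≤ r)
    (h : ∑' i, ENNReal.ofReal (f i) = ENNReal.ofReal r) : HasSum f r := by
  have hs : Summable f := by
    refine (ENNReal.summable_toReal (h ▸ ENNReal.ofReal_ne_top)).congr fun i => ?_
    rw [ENNReal.toReal_ofReal (hf i)]
  rw [← ENNReal.ofReal_tsum_of_nonneg hf hs,
    ENNReal.ofReal_eq_ofReal_iff (tsum_nonneg hf) hr] at h
  exact h ▸ hs.hasSum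

lemma isTraceClass_rankOne (u v : H) : IsTraceClass (InnerProductSpace.rankOne ℂ u v) :=
  IsTraceClass.of_summable fun W => by
    refine ((basis H).hasSum_inner_mul_inner v (W u)).summable.congr fun i => ?_
    rw [InnerProductSpace.rankOne_apply, map_smul, inner_smul_right]

/-- The rank one operator `|u⟩⟨v|`, as a trace class operator. -/
def ketbra (u v : H) : traceClass H := ⟨InnerProductSpace.rankOne ℂ u v, isTraceClass_rankOne u v⟩

lemma ketbra_coe (u v : H) : (ketbra u v : H →L[ℂ] H) = InnerProductSpace.rankOne ℂ u v := rfl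

lemma inner_ketbra (u v x y : H) :
    inner ℂ x ((ketbra u v : H →L[ℂ] H) y) = inner ℂ x u * inner ℂ v y := by
  rw [ketbra_coe, InnerProductSpace.rankOne_apply, inner_smul_right, mul_comm]

lemma isPositive_ketbra (u : H) : (ketbra u u : H →L[ℂ] H).IsPositive :=
  InnerProductSpace.isPositive_rankOne_self u

lemma inner_ketbra_self (u x : H) :
    inner ℂ x ((ketbra u u : H →L[ℂ] H) x) = ((‖inner ℂ x u‖ ^ 2 : ℝ) : ℂ) := by
  rw [inner_ketbra, ← inner_conj_symm u x, Complex.mul_conj, Complex.normSq_eq_norm_sq]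

lemma tsum_unit_ketbra (u x : H) : ∑' _ : Unit, ‖inner ℂ x u‖ₑ ^ 2 =
    ENNReal.ofReal (inner ℂ x ((ketbra u u : H →L[ℂ] H) x)).re := by
  rw [tsum_fintype, inner_ketbra_self, Complex.ofReal_re, ENNReal.ofReal_pow (norm_nonneg _),
    ofReal_norm]
  simp

lemma etrace_conj_ketbra (K : H →L[ℂ] H) (u : H) :
    etrace (conj K (ketbra u u) : H →L[ℂ] H) = ‖K u‖ₑ ^ 2 := by
  rw [conj_coe, etrace_conj_eq (tsum_unit_ketbra u)]
  simp

lemma etrace_ketbra (u : H) : etrace (ketbra u u : H →L[ℂ] H) = ‖u‖ₑ ^ 2 := by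
  rw [etrace_eq (tsum_unit_ketbra u)]
  simp

/-- The remainders of a weakly convergent sum of positive trace class operators are positive and
tend to zero in trace. -/
lemma remainder_of_hasSum {ι : Type*} {T : traceClass H} {S : ι → traceClass H}
    (hS : ∀ j, (S j : H →L[ℂ] H).IsPositive)
    (h : ∀ x, HasSum (fun j => inner ℂ x ((S j : H →L[ℂ] H) x))
      (inner ℂ x ((T : H →L[ℂ] H) x))) :
    (∀ s : Finset ι, ((T - ∑ j ∈ s, S j : traceClass H) : H →L[ℂ] H).IsPositive) ∧
    Filter.Tendsto
      (fun s : Finset ι => etrace ((T - ∑ j ∈ s, S j : traceClass H) : H →L[ℂ] H))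
      Filter.atTop (nhds 0) := by
  have hT : (T : H →L[ℂ] H).IsPositive := isPositive_of_hasSum hS h
  have key : ∀ (s : Finset ι) (x : H),
      HasSum (fun j : {j // j ∉ s} => inner ℂ x ((S j : H →L[ℂ] H) x))
        (inner ℂ x (((T - ∑ j ∈ s, S j : traceClass H) : H →L[ℂ] H) x)) := fun s x => by
    refine (Finset.hasSum_compl_iff (f := fun j => inner ℂ x ((S j : H →L[ℂ] H) x)) s).2 ?_
    have e : inner ℂ x (((T - ∑ j ∈ s, S j : traceClass H) : H →L[ℂ] H) x) +
        ∑ j ∈ s, inner ℂ x ((S j : H →L[ℂ] H) x) = inner ℂ x ((T : H →L[ℂ] H) x) := by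
      simp [sum_apply]
    rw [e]
    exact h x
  refine ⟨fun s => isPositive_of_hasSum (S := fun j : {j // j ∉ s} => (S j : H →L[ℂ] H))
    (fun j => hS j) (key s), ?_⟩
  have h2 : ∀ s : Finset ι, etrace ((T - ∑ j ∈ s, S j : traceClass H) : H →L[ℂ] H) =
      ∑' j : {j // j ∉ s}, etrace (S j : H →L[ℂ] H) := fun s =>
    etrace_eq_tsum (S := fun j : {j // j ∉ s} => (S j : H →L[ℂ] H)) (fun j => hS j) (key s)
  simp_rw [h2]
  refine ENNReal.tendsto_tsum_compl_atTop_zero (f := fun j => etrace (S j : H →L[ℂ] H)) ?_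
  rw [← etrace_eq_tsum hS h]
  exact etrace_ne_top hT

/-- A positive trace class operator is a weakly convergent sum of operators `|u⟩⟨u|`. -/
lemma exists_hasSum_ketbra {ρ : traceClass H} (hρ : (ρ : H →L[ℂ] H).IsPositive) :
    ∃ u : basisSet H → H, ∀ x,
      HasSum (fun n => inner ℂ x ((ketbra (u n) (u n) : H →L[ℂ] H) x))
        (inner ℂ x ((ρ : H →L[ℂ] H) x)) := by
  obtain ⟨u, hu⟩ := exists_vectors hρ
  refine ⟨u, fun x => ?_⟩
  rw [inner_eq_ofReal hρ]
  simp_rw [inner_ketbra_self]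
  refine Complex.hasSum_ofReal.2
    (hasSum_of_tsum_ofReal (fun i => by positivity) (re_inner_nonneg hρ x) ?_)
  rw [← hu]
  exact tsum_congr fun n => by rw [ENNReal.ofReal_pow (norm_nonneg _), ofReal_norm]

/-! ### Operations on positive operators -/

lemma IsCompletelyPositive.isPositive {Φ : traceClass H →ₗ[ℂ] traceClass H}
    (hΦ : IsCompletelyPositive Φ) {ρ : traceClass H} (hρ : (ρ : H →L[ℂ] H).IsPositive) :
    (Φ ρ : H →L[ℂ] H).IsPositive := by
  rw [isPositive_iff_inner_nonneg]
  intro x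
  have := hΦ 1 (fun _ _ => ρ) (fun x => by simpa using hρ.inner_nonneg_right (x 0)) fun _ => x
  simpa using this

lemma trace_le_trace_iff {ρ σ : traceClass H} (hρ : (ρ : H →L[ℂ] H).IsPositive)
    (hσ : (σ : H →L[ℂ] H).IsPositive) :
    trace ρ ≤ trace σ ↔ etrace (ρ : H →L[ℂ] H) ≤ etrace (σ : H →L[ℂ] H) := by
  rw [trace_of_isPositive hρ, trace_of_isPositive hσ, Complex.real_le_real, ← ofReal_traceNorm hρ,
    ← ofReal_traceNorm hσ, ENNReal.ofReal_le_ofReal_iff (traceNorm_nonneg _)]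

lemma trace_eq_trace_iff {ρ σ : traceClass H} (hρ : (ρ : H →L[ℂ] H).IsPositive)
    (hσ : (σ : H →L[ℂ] H).IsPositive) :
    trace ρ = trace σ ↔ etrace (ρ : H →L[ℂ] H) = etrace (σ : H →L[ℂ] H) := by
  rw [le_antisymm_iff, trace_le_trace_iff hρ hσ, trace_le_trace_iff hσ hρ, ← le_antisymm_iff]

/-- A nonzero positive trace class operator is a positive multiple of a state. -/
lemma eq_zero_or_exists_isState {ρ : traceClass H} (hρ : (ρ : H →L[ℂ] H).IsPositive) :
    ρ = 0 ∨ ∃ (t : ℝ) (σ : traceClass H), 0 < t ∧ IsState σ ∧ ρ = (t : ℂ) • σ := by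
  rcases (traceNorm_nonneg ρ).eq_or_lt with h0 | h0
  · left
    have := norm_le_traceNorm ρ
    rw [← h0] at this
    exact Subtype.ext (norm_le_zero_iff.1 this)
  · right
    have hne : (traceNorm ρ : ℂ) ≠ 0 := by exact_mod_cast h0.ne'
    refine ⟨traceNorm ρ, ((traceNorm ρ : ℂ))⁻¹ • ρ, h0, ⟨?_, ?_⟩, ?_⟩
    · refine hρ.smul_of_nonneg ?_
      rw [← Complex.ofReal_inv]
      exact Complex.zero_le_real.2 (inv_nonneg.2 h0.le)
    · rw [trace_smul, trace_of_isPositive hρ, inv_mul_cancel₀ hne]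
    · rw [smul_smul, mul_inv_cancel₀ hne, one_smul]

lemma IsOperation.etrace_le {Φ : traceClass H →ₗ[ℂ] traceClass H} (hΦ : IsOperation Φ)
    {ρ : traceClass H} (hρ : (ρ : H →L[ℂ] H).IsPositive) :
    etrace (Φ ρ : H →L[ℂ] H) ≤ etrace (ρ : H →L[ℂ] H) := by
  rw [← trace_le_trace_iff (hΦ.1.isPositive hρ) hρ]
  obtain rfl | ⟨t, σ, ht, hσ, rfl⟩ := eq_zero_or_exists_isState hρ
  · rw [map_zero]
  · rw [map_smul, trace_smul, trace_smul]
    exact mul_le_mul_of_nonneg_left (hΦ.2 σ hσ) (Complex.zero_le_real.2 ht.le)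

lemma IsChannel.etrace_eq {Φ : traceClass H →ₗ[ℂ] traceClass H} (hΦ : IsChannel Φ)
    {ρ : traceClass H} (hρ : (ρ : H →L[ℂ] H).IsPositive) :
    etrace (Φ ρ : H →L[ℂ] H) = etrace (ρ : H →L[ℂ] H) := by
  rw [← trace_eq_trace_iff (hΦ.1.1.isPositive hρ) hρ]
  obtain rfl | ⟨t, σ, ht, hσ, rfl⟩ := eq_zero_or_exists_isState hρ
  · rw [map_zero]
  · rw [map_smul, trace_smul, trace_smul, hΦ.2 σ hσ]

lemma enorm_le_etrace {ρ : traceClass H} (hρ : (ρ : H →L[ℂ] H).IsPositive) :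
    ‖(ρ : H →L[ℂ] H)‖ₑ ≤ etrace (ρ : H →L[ℂ] H) := by
  rw [← ofReal_traceNorm hρ, ← ofReal_norm]
  exact ENNReal.ofReal_le_ofReal (norm_le_traceNorm ρ)

/-- Operations are determined by their values on rank one operators: the remainders of
`ρ = ∑ n, |u n⟩⟨u n|` tend to zero in trace, hence so do their images. -/
lemma IsOperation.ext {Φ Ψ : traceClass H →ₗ[ℂ] traceClass H} (hΦ : IsOperation Φ)
    (hΨ : IsOperation Ψ) (h : ∀ u, Φ (ketbra u u) = Ψ (ketbra u u)) : Φ = Ψ := by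
  refine LinearMap.ext fun ρ => ?_
  refine traceClass_induction (p := fun ρ => Φ ρ = Ψ ρ) (fun ρ hρ => ?_)
    (fun ρ σ h1 h2 => by rw [map_add, map_add, h1, h2])
    (fun c ρ h1 => by rw [map_smul, map_smul, h1]) ρ
  obtain ⟨u, hu⟩ := exists_hasSum_ketbra hρ
  obtain ⟨hpos, hlim⟩ := remainder_of_hasSum (fun n => isPositive_ketbra (u n)) hu
  have hle : ∀ s : Finset (basisSet H), ‖(Φ ρ : H →L[ℂ] H) - Ψ ρ‖ₑ ≤
      2 * etrace ((ρ - ∑ n ∈ s, ketbra (u n) (u n) : traceClass H) : H →L[ℂ] H) := fun s => by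
    set σ := ρ - ∑ n ∈ s, ketbra (u n) (u n) with hσ
    have e : (Φ ρ : H →L[ℂ] H) - Ψ ρ = Φ σ - Ψ σ := by
      have e1 : Φ ρ - Ψ ρ = Φ σ - Ψ σ := by
        rw [hσ, map_sub, map_sub, map_sum, map_sum, Finset.sum_congr rfl fun n _ => h (u n)]
        abel
      exact congrArg Subtype.val e1
    rw [e, two_mul]
    refine (enorm_sub_le).trans (add_le_add ?_ ?_)
    · exact (enorm_le_etrace (hΦ.1.isPositive (hpos s))).trans (hΦ.etrace_le (hpos s))
    · exact (enorm_le_etrace (hΨ.1.isPositive (hpos s))).trans (hΨ.etrace_le (hpos s))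
  have hlim2 := ENNReal.Tendsto.const_mul (a := 2) hlim (Or.inr (by simp))
  rw [mul_zero] at hlim2
  have h0 : ‖(Φ ρ : H →L[ℂ] H) - Ψ ρ‖ₑ = 0 :=
    le_antisymm (ge_of_tendsto' hlim2 hle) zero_le
  exact Subtype.ext (sub_eq_zero.1 (enorm_eq_zero.1 h0))

/-! ### Kraus sums -/

/-- `Φ(ρ) = ∑ j, K_j ρ K_j*` for all trace class `ρ`, the sum converging in the weak operator
topology. -/
def HasWeakKrausSum {ι : Type*} (K : ι → H →L[ℂ] H)
    (Φ : traceClass H →ₗ[ℂ] traceClass H) : Prop :=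
  ∀ (ρ : traceClass H) (x y : H), HasSum (fun j => inner ℂ x ((conj (K j) ρ : H →L[ℂ] H) y))
    (inner ℂ x ((Φ ρ : H →L[ℂ] H) y))

variable {ι : Type*} {K : ι → H →L[ℂ] H} {Φ Ψ : traceClass H →ₗ[ℂ] traceClass H}

lemma HasWeakKrausSum.unique (hΦ : HasWeakKrausSum K Φ) (hΨ : HasWeakKrausSum K Ψ) : Φ = Ψ := by
  refine LinearMap.ext fun ρ => Subtype.ext (ContinuousLinearMap.ext fun y => ?_)
  exact ext_inner_left ℂ fun x => (hΦ ρ x y).unique (hΨ ρ x y)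

lemma HasWeakKrausSum.isCompletelyPositive (hΦ : HasWeakKrausSum K Φ) :
    IsCompletelyPositive Φ := by
  intro n ρ hρ x
  have h : HasSum (fun k => ∑ i, ∑ j, inner ℂ (x i) ((conj (K k) (ρ i j) : H →L[ℂ] H) (x j)))
      (∑ i, ∑ j, inner ℂ (x i) ((Φ (ρ i j) : H →L[ℂ] H) (x j))) :=
    hasSum_sum fun i _ => hasSum_sum fun j _ => hΦ (ρ i j) (x i) (x j)
  refine h.nonneg fun k => ?_
  simp_rw [inner_conj_apply]
  exact hρ fun i => star (K k) (x i)

lemma HasWeakKrausSum.etrace_eq (hΦ : HasWeakKrausSum K Φ) {ρ : traceClass H}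
    (hρ : (ρ : H →L[ℂ] H).IsPositive) :
    etrace (Φ ρ : H →L[ℂ] H) = ∑' j, etrace (conj (K j) ρ : H →L[ℂ] H) :=
  etrace_eq_tsum (fun j => isPositive_conj (K j) hρ) fun x => hΦ ρ x x

lemma tsum_etrace_conj_le (hK : ∀ ψ, ∑' j, ‖K j ψ‖ₑ ^ 2 ≤ ‖ψ‖ₑ ^ 2) {ρ : traceClass H}
    (hρ : (ρ : H →L[ℂ] H).IsPositive) :
    ∑' j, etrace (conj (K j) ρ : H →L[ℂ] H) ≤ etrace (ρ : H →L[ℂ] H) := by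
  obtain ⟨u, hu⟩ := exists_vectors hρ
  simp_rw [conj_coe, etrace_conj_eq hu]
  rw [ENNReal.tsum_comm, QuantumDevice.etrace_eq hu]
  exact ENNReal.tsum_le_tsum fun n => hK (u n)

lemma tsum_etrace_conj_eq (hK : ∀ ψ, ∑' j, ‖K j ψ‖ₑ ^ 2 = ‖ψ‖ₑ ^ 2) {ρ : traceClass H}
    (hρ : (ρ : H →L[ℂ] H).IsPositive) :
    ∑' j, etrace (conj (K j) ρ : H →L[ℂ] H) = etrace (ρ : H →L[ℂ] H) := by
  obtain ⟨u, hu⟩ := exists_vectors hρ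
  simp_rw [conj_coe, etrace_conj_eq hu]
  rw [ENNReal.tsum_comm, QuantumDevice.etrace_eq hu]
  exact tsum_congr fun n => hK (u n)

lemma HasWeakKrausSum.isOperation (hΦ : HasWeakKrausSum K Φ)
    (hK : ∀ ψ, ∑' j, ‖K j ψ‖ₑ ^ 2 ≤ ‖ψ‖ₑ ^ 2) : IsOperation Φ := by
  refine ⟨hΦ.isCompletelyPositive, fun ρ hρ => ?_⟩
  rw [trace_le_trace_iff (hΦ.isCompletelyPositive.isPositive hρ.1) hρ.1, hΦ.etrace_eq hρ.1]
  exact tsum_etrace_conj_le hK hρ.1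

lemma HasWeakKrausSum.isChannel (hΦ : HasWeakKrausSum K Φ)
    (hK : ∀ ψ, ∑' j, ‖K j ψ‖ₑ ^ 2 = ‖ψ‖ₑ ^ 2) : IsChannel Φ := by
  refine ⟨hΦ.isOperation fun ψ => (hK ψ).le, fun ρ hρ => ?_⟩
  rw [trace_eq_trace_iff (hΦ.isCompletelyPositive.isPositive hρ.1) hρ.1, hΦ.etrace_eq hρ.1]
  exact tsum_etrace_conj_eq hK hρ.1

lemma HasWeakKrausSum.tsum_enorm_sq (hΦ : HasWeakKrausSum K Φ) (ψ : H) :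
    ∑' j, ‖K j ψ‖ₑ ^ 2 = etrace (Φ (ketbra ψ ψ) : H →L[ℂ] H) := by
  rw [hΦ.etrace_eq (isPositive_ketbra ψ)]
  simp_rw [etrace_conj_ketbra]

lemma summable_norm_conj (hK : ∀ ψ, ∑' j, ‖K j ψ‖ₑ ^ 2 ≤ ‖ψ‖ₑ ^ 2) (ρ : traceClass H) :
    Summable fun j => ‖(conj (K j) ρ : H →L[ℂ] H)‖ := by
  refine traceClass_induction
    (p := fun ρ => Summable fun j => ‖(conj (K j) ρ : H →L[ℂ] H)‖) (fun ρ hρ => ?_)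
    (fun ρ σ h1 h2 => ?_) (fun c ρ h => ?_) ρ
  · have h : ∑' j, etrace (conj (K j) ρ : H →L[ℂ] H) ≠ ⊤ :=
      ne_top_of_le_ne_top (etrace_ne_top hρ) (tsum_etrace_conj_le hK hρ)
    refine Summable.of_nonneg_of_le (fun j => norm_nonneg _) (fun j => ?_)
      (ENNReal.summable_toReal h)
    rw [← traceNorm_of_isPositive (isPositive_conj (K j) hρ)]
    exact norm_le_traceNorm _
  · refine Summable.of_nonneg_of_le (fun j => norm_nonneg _) (fun j => ?_) (h1.add h2)
    rw [map_add, Submodule.coe_add]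
    exact norm_add_le _ _
  · refine (h.mul_left ‖c‖).congr fun j => ?_
    rw [map_smul, Submodule.coe_smul, norm_smul]

lemma hasSum_inner_of_hasSum {S : ι → H →L[ℂ] H} {T : H →L[ℂ] H} (h : HasSum S T) (x y : H) :
    HasSum (fun j => inner ℂ x (S j y)) (inner ℂ x (T y)) :=
  (h.mapL (ContinuousLinearMap.apply ℂ H y)).mapL (innerSL ℂ x)

/-- A family with `∑ j, K_j* K_j ≤ 1` is the Kraus family of some operation: the sums
`∑ j, K_j ρ K_j*` converge in operator norm, and the limit is again trace class. -/
lemma exists_hasWeakKrausSum (hK : ∀ ψ, ∑' j, ‖K j ψ‖ₑ ^ 2 ≤ ‖ψ‖ₑ ^ 2) :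
    ∃ Φ : traceClass H →ₗ[ℂ] traceClass H, HasWeakKrausSum K Φ := by
  have hs : ∀ ρ : traceClass H, Summable fun j => (conj (K j) ρ : H →L[ℂ] H) := fun ρ =>
    (summable_norm_conj hK ρ).of_norm
  have hadd : ∀ ρ σ : traceClass H, ∑' j, (conj (K j) (ρ + σ) : H →L[ℂ] H) =
      ∑' j, (conj (K j) ρ : H →L[ℂ] H) + ∑' j, (conj (K j) σ : H →L[ℂ] H) := fun ρ σ => by
    rw [← (hs ρ).tsum_add (hs σ)]
    simp
  have hsmul : ∀ (c : ℂ) (ρ : traceClass H), ∑' j, (conj (K j) (c • ρ) : H →L[ℂ] H) =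
      c • ∑' j, (conj (K j) ρ : H →L[ℂ] H) := fun c ρ => by
    rw [← (hs ρ).tsum_const_smul]
    simp
  have htc : ∀ ρ : traceClass H, (∑' j, (conj (K j) ρ : H →L[ℂ] H)) ∈ traceClass H := fun ρ => by
    refine traceClass_induction
      (p := fun ρ => (∑' j, (conj (K j) ρ : H →L[ℂ] H)) ∈ traceClass H) (fun ρ hρ => ?_)
      (fun ρ σ h1 h2 => ?_) (fun c ρ h => ?_) ρ
    · have hpos := fun j => isPositive_conj (K j) hρ
      have hsum := fun x => hasSum_inner_of_hasSum (hs ρ).hasSum x x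
      refine (isTraceClass_iff_etrace_ne_top (isPositive_of_hasSum hpos hsum)).2 ?_
      rw [etrace_eq_tsum hpos hsum]
      exact ne_top_of_le_ne_top (etrace_ne_top hρ) (tsum_etrace_conj_le hK hρ)
    · rw [hadd]
      exact add_mem h1 h2
    · rw [hsmul]
      exact Submodule.smul_mem _ c h
  exact ⟨{ toFun := fun ρ => ⟨_, htc ρ⟩
           map_add' := fun ρ σ => Subtype.ext (hadd ρ σ)
           map_smul' := fun c ρ => Subtype.ext (hsmul c ρ) },
    fun ρ x y => hasSum_inner_of_hasSum (hs ρ).hasSum x y⟩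

/-- A weakly convergent Kraus sum converges unconditionally in trace norm. -/
lemma HasWeakKrausSum.tendsto_traceNorm (hΦ : HasWeakKrausSum K Φ) (ρ : traceClass H) :
    Filter.Tendsto (fun s : Finset ι => traceNorm (Φ ρ - ∑ j ∈ s, conj (K j) ρ))
      Filter.atTop (nhds 0) := by
  refine traceClass_induction (p := fun ρ => Filter.Tendsto
    (fun s : Finset ι => traceNorm (Φ ρ - ∑ j ∈ s, conj (K j) ρ)) Filter.atTop (nhds 0))
    (fun ρ hρ => ?_) (fun ρ σ h1 h2 => ?_) (fun c ρ h => ?_) ρ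
  · obtain ⟨hpos, hlim⟩ := remainder_of_hasSum (fun j => isPositive_conj (K j) hρ)
      fun x => hΦ ρ x x
    simp_rw [fun s => traceNorm_of_isPositive (hpos s)]
    exact (ENNReal.tendsto_toReal ENNReal.zero_ne_top).comp hlim
  · refine squeeze_zero (fun s => traceNorm_nonneg _) (fun s => ?_) (by simpa using h1.add h2)
    refine le_trans (le_of_eq ?_) (traceNorm_add_le _ _)
    congr 1
    simp only [map_add, Finset.sum_add_distrib]
    abel
  · have e : ∀ s : Finset ι, traceNorm (Φ (c • ρ) - ∑ j ∈ s, conj (K j) (c • ρ)) =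
        ‖c‖ * traceNorm (Φ ρ - ∑ j ∈ s, conj (K j) ρ) := fun s => by
      rw [← traceNorm_smul, smul_sub, Finset.smul_sum]
      simp only [map_smul]
    simp_rw [e]
    simpa using h.const_mul ‖c‖

lemma hasKrausSum_iff {K : ℕ → H →L[ℂ] H} {J : Set ℕ} :
    HasKrausSum K J Φ ↔ HasWeakKrausSum (fun j : J => K j) Φ := by
  refine ⟨fun h ρ x y => ?_, fun h ρ => h.tendsto_traceNorm ρ⟩
  have h0 := ((h ρ).const_mul ‖x‖).mul_const ‖y‖
  rw [mul_zero, zero_mul] at h0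
  rw [HasSum, SummationFilter.unconditional_filter, tendsto_iff_norm_sub_tendsto_zero]
  refine squeeze_zero (fun s => norm_nonneg _) (fun s => ?_) h0
  have e : ∑ j ∈ s, inner ℂ x ((conj (K j) ρ : H →L[ℂ] H) y) - inner ℂ x ((Φ ρ : H →L[ℂ] H) y) =
      - inner ℂ x (((Φ ρ - ∑ j ∈ s, conj (K j) ρ : traceClass H) : H →L[ℂ] H) y) := by
    simp [sum_apply]
  rw [e, norm_neg, mul_assoc]
  refine (norm_inner_le_norm _ _).trans ?_
  gcongr
  refine (ContinuousLinearMap.le_opNorm _ _).trans ?_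
  gcongr
  exact norm_le_traceNorm _

/-- `∑ j, K_j* K_j = 1` strongly, if and only if `∑ j, ‖K_j ψ‖² = ‖ψ‖²` for all `ψ`. -/
lemma isComplete_iff {K : ℕ → H →L[ℂ] H} {J : Set ℕ} :
    IsComplete K J ↔ ∀ ψ, ∑' j : J, ‖K j ψ‖ₑ ^ 2 = ‖ψ‖ₑ ^ 2 := by
  have hin : ∀ (A : H →L[ℂ] H) (ψ : H), inner ℂ ψ ((star A * A) ψ) = ((‖A ψ‖ ^ 2 : ℝ) : ℂ) :=
    fun A ψ => by
      rw [mul_apply_eq_comp, ContinuousLinearMap.star_eq_adjoint,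
        ContinuousLinearMap.adjoint_inner_right, inner_self_eq_norm_sq_to_K]
      norm_cast
  have hself : ∀ ψ : H, inner ℂ ψ ψ = ((‖ψ‖ ^ 2 : ℝ) : ℂ) := fun ψ => by
    rw [inner_self_eq_norm_sq_to_K]
    norm_cast
  have hen : ∀ ψ : H, ENNReal.ofReal (‖ψ‖ ^ 2) = ‖ψ‖ₑ ^ 2 := fun ψ => by
    rw [ENNReal.ofReal_pow (norm_nonneg _), ofReal_norm]
  have hreal : ∀ ψ, (∑' j : J, ‖K j ψ‖ₑ ^ 2 = ‖ψ‖ₑ ^ 2) ↔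
      HasSum (fun j : J => ‖K j ψ‖ ^ 2) (‖ψ‖ ^ 2) := fun ψ => by
    simp_rw [← hen]
    refine ⟨hasSum_of_tsum_ofReal (fun j => by positivity) (by positivity), fun h => ?_⟩
    rw [← h.tsum_eq, ENNReal.ofReal_tsum_of_nonneg (fun j => by positivity) h.summable]
  simp_rw [hreal]
  refine ⟨fun h ψ => ?_, fun h ψ => ?_⟩
  · have := (h ψ).mapL (innerSL ℂ ψ)
    simp only [innerSL_apply_apply, hin, hself] at this
    exact Complex.hasSum_ofReal.1 this
  · -- The remainders `B s = 1 - ∑ j ∈ s, K_j* K_j` satisfy `0 ≤ B s ≤ 1`, so that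
    -- `‖B s ψ‖² ≤ ⟨ψ, B s ψ⟩`.
    let B : Finset J → H →L[ℂ] H := fun s => 1 - ∑ j ∈ s, star (K j) * K j
    have hB : ∀ s φ, inner ℂ φ (B s φ) = ((‖φ‖ ^ 2 - ∑ j ∈ s, ‖K j φ‖ ^ 2 : ℝ) : ℂ) :=
      fun s φ => by
        simp only [B, sub_apply, one_apply_eq_self, sum_apply, inner_sub_right, inner_sum, hin,
          hself]
        push_cast
        rfl
    have hB0 : ∀ (s : Finset J) (φ : H), 0 ≤ ‖φ‖ ^ 2 - ∑ j ∈ s, ‖K j φ‖ ^ 2 := fun s φ =>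
      sub_nonneg.2 (sum_le_hasSum (f := fun j : J => ‖K j φ‖ ^ 2) s (fun j _ => by positivity) (h φ))
    have hBpos : ∀ s, (B s).IsPositive := fun s => by
      rw [isPositive_iff_inner_nonneg]
      intro φ
      rw [hB]
      exact Complex.zero_le_real.2 (hB0 s φ)
    have hsq : ∀ s φ, ‖B s φ‖ ^ 2 ≤ ‖φ‖ ^ 2 - ∑ j ∈ s, ‖K j φ‖ ^ 2 := fun s φ => by
      obtain ⟨R, hRR, hR⟩ := exists_sqrt (hBpos s)
      have hRn : ∀ φ, ‖R φ‖ ^ 2 = ‖φ‖ ^ 2 - ∑ j ∈ s, ‖K j φ‖ ^ 2 := fun φ => by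
        have := hB s φ
        rw [← hRR, mul_apply_eq_comp, hR, hself] at this
        exact_mod_cast this
      rw [← hRR, mul_apply_eq_comp, hRn (R φ), ← hRn φ]
      exact sub_le_self _ (Finset.sum_nonneg fun j _ => by positivity)
    have hlim : Filter.Tendsto (fun s : Finset J => ‖ψ‖ ^ 2 - ∑ j ∈ s, ‖K j ψ‖ ^ 2)
        Filter.atTop (nhds 0) := by
      have := (h ψ).const_sub (‖ψ‖ ^ 2)
      rwa [sub_self] at this
    have hlim2 : Filter.Tendsto (fun s => ‖B s ψ‖ ^ 2) Filter.atTop (nhds 0) :=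
      squeeze_zero (fun s => by positivity) (fun s => hsq s ψ) hlim
    have hlim3 := hlim2.sqrt
    simp only [Real.sqrt_sq (norm_nonneg _), Real.sqrt_zero] at hlim3
    rw [HasSum, SummationFilter.unconditional_filter, tendsto_iff_norm_sub_tendsto_zero]
    refine hlim3.congr fun s => ?_
    rw [norm_sub_rev]
    simp [B]

/-! ### Existence of Kraus families -/

lemma ketbra_add_left (u u' v : H) : ketbra (u + u') v = ketbra u v + ketbra u' v :=
  Subtype.ext (by simp [ketbra_coe])

lemma ketbra_add_right (u v v' : H) : ketbra u (v + v') = ketbra u v + ketbra u v' :=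
  Subtype.ext (by simp [ketbra_coe])

lemma ketbra_smul_left (c : ℂ) (u v : H) : ketbra (c • u) v = c • ketbra u v :=
  Subtype.ext (by simp [ketbra_coe])

lemma ketbra_smul_right (c : ℂ) (u v : H) :
    ketbra u (c • v) = (starRingEnd ℂ c) • ketbra u v :=
  Subtype.ext (by simp [ketbra_coe])

lemma IsCompletelyPositive.star_ketbra {Φ : traceClass H →ₗ[ℂ] traceClass H}
    (hΦ : IsCompletelyPositive Φ) (u v : H) :
    star (Φ (ketbra u v) : H →L[ℂ] H) = Φ (ketbra v u) := by
  have hsa : ∀ w, star (Φ (ketbra w w) : H →L[ℂ] H) = Φ (ketbra w w) := fun w =>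
    (hΦ.isPositive (isPositive_ketbra w)).isSelfAdjoint
  have h1 := hsa (u + v)
  have h2 := hsa (u + Complex.I • v)
  simp only [ketbra_add_left, ketbra_add_right, ketbra_smul_left, ketbra_smul_right, map_add,
    map_smul, Submodule.coe_add, Submodule.coe_smul, star_add, star_smul, hsa,
    Complex.star_def, Complex.conj_I, map_neg] at h1 h2
  set A := (Φ (ketbra u v) : H →L[ℂ] H)
  set B := (Φ (ketbra v u) : H →L[ℂ] H)
  have e1 : star A + star B = A + B := by
    have := congrArg (fun T => T - (Φ (ketbra u u) : H →L[ℂ] H) - Φ (ketbra v v)) h1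
    convert this using 1 <;> abel
  have e2 : Complex.I • (star A - star B) = Complex.I • (B - A) := by
    have := congrArg (fun T => T - (Φ (ketbra u u) : H →L[ℂ] H) -
      Complex.I • (-Complex.I) • (Φ (ketbra v v) : H →L[ℂ] H)) h2
    convert this using 1
    · module
    · module
  have e3 : star A - star B = B - A := smul_right_injective _ Complex.I_ne_zero e2
  have e4 : (2 : ℂ) • star A = (2 : ℂ) • B := by
    have := congrArg₂ (· + ·) e1 e3
    convert this using 1 <;> module
  exact smul_right_injective _ two_ne_zero e4

lemma IsCompletelyPositive.sum_inner_nonneg {Φ : traceClass H →ₗ[ℂ] traceClass H}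
    (hΦ : IsCompletelyPositive Φ) (s : Finset H) (f : H → H) :
    0 ≤ ∑ u ∈ s, ∑ v ∈ s, inner ℂ (f u) ((Φ (ketbra u v) : H →L[ℂ] H) (f v)) := by
  let e := s.equivFin
  have h := hΦ s.card (fun i j => ketbra (e.symm i : H) (e.symm j : H)) (fun x => ?_)
    fun i => f (e.symm i)
  · have h2 : ∀ g : H → ℂ, ∑ i, g (e.symm i : H) = ∑ u ∈ s, g u := fun g => by
      rw [Equiv.sum_comp e.symm (fun u : s => g u), Finset.sum_coe_sort s g]
    rw [← h2 fun u => ∑ v ∈ s, inner ℂ (f u) ((Φ (ketbra u v) : H →L[ℂ] H) (f v))]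
    simp_rw [← h2]
    exact h
  · have h3 : ∀ i, inner ℂ (e.symm i : H) (x i) =
        (starRingEnd ℂ) (inner ℂ (x i) (e.symm i : H)) := fun i => (inner_conj_symm _ _).symm
    simp_rw [inner_ketbra, ← Finset.mul_sum, h3, ← map_sum]
    rw [← Finset.sum_mul, Complex.mul_conj]
    exact Complex.zero_le_real.2 (Complex.normSq_nonneg _)

/-- The operator-valued kernel `(u, v) ↦ Φ(|u⟩⟨v|)` on `H` attached to a map `Φ`. -/
def krausKernel (Φ : traceClass H →ₗ[ℂ] traceClass H) : Matrix H H (H →L[ℂ] H) :=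
  Matrix.of fun u v => (Φ (ketbra u v) : H →L[ℂ] H)

lemma krausKernel_apply (Φ : traceClass H →ₗ[ℂ] traceClass H) (u v : H) :
    krausKernel Φ u v = (Φ (ketbra u v) : H →L[ℂ] H) := rfl

lemma IsCompletelyPositive.posSemidef_krausKernel {Φ : traceClass H →ₗ[ℂ] traceClass H}
    (hΦ : IsCompletelyPositive Φ) : (krausKernel Φ).PosSemidef := by
  have key := (RKHS.posSemidef_tfae (K := krausKernel Φ)).out 2 0
  refine key.1 ⟨?_, fun f => ?_⟩
  · ext1 u v
    rw [Matrix.conjTranspose_apply, krausKernel_apply, krausKernel_apply, hΦ.star_ketbra]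
  · have h := (Complex.nonneg_iff.1 (hΦ.sum_inner_nonneg f.support f)).1
    rw [Finset.sum_comm] at h
    simp only [Complex.re_sum] at h
    simp only [Finsupp.sum, map_sum, krausKernel_apply]
    convert h using 4
    exact inner_re_symm (𝕜 := ℂ) _ _

/-- The reproducing kernel Hilbert space of the kernel `Φ(|u⟩⟨v|)` is the closed span of vectors
`F u x` whose inner products are the matrix elements of `Φ(|u⟩⟨v|)`. -/
lemma IsCompletelyPositive.exists_gram {H : Type u} [NormedAddCommGroup H]
    [InnerProductSpace ℂ H] [CompleteSpace H] {Φ : traceClass H →ₗ[ℂ] traceClass H}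
    (hΦ : IsCompletelyPositive Φ) :
    ∃ (G : Type u) (_ : NormedAddCommGroup G) (_ : InnerProductSpace ℂ G) (_ : CompleteSpace G)
      (F : H → H →L[ℂ] G),
      (∀ u v x y, inner ℂ (F u x) (F v y) = inner ℂ x ((Φ (ketbra u v) : H →L[ℂ] H) y)) ∧
      (Submodule.span ℂ {g | ∃ u x, F u x = g}).topologicalClosure = ⊤ := by
  have : Fact (krausKernel Φ).PosSemidef := ⟨hΦ.posSemidef_krausKernel⟩
  refine ⟨RKHS.OfKernel (krausKernel Φ), inferInstance, inferInstance, inferInstance,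
    RKHS.kerFun (RKHS.OfKernel (krausKernel Φ)), fun u v x y => ?_, RKHS.kerFun_dense _⟩
  have h := RKHS.kernel_inner (RKHS.OfKernel (krausKernel Φ)) u v y x
  rw [RKHS.OfKernel.kernel_ofKernel, krausKernel_apply] at h
  rw [← inner_conj_symm, ← h, inner_conj_symm]

/-- An orthonormal family in a separable inner product space is countable. -/
lemma countable_of_orthonormal {ι G : Type*} [NormedAddCommGroup G] [InnerProductSpace ℂ G]
    [TopologicalSpace.SeparableSpace G] {b : ι → G} (hb : Orthonormal ℂ b) : Countable ι := by
  rw [← Set.countable_univ_iff]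
  refine Set.PairwiseDisjoint.countable_of_isOpen (s := fun i => Metric.ball (b i) (1 / 2)) ?_
    (fun _ _ => Metric.isOpen_ball) (fun i _ => ⟨b i, Metric.mem_ball_self (by norm_num)⟩)
  intro i _ j _ hij
  refine Metric.ball_disjoint_ball ?_
  have h : ‖b i - b j‖ ^ 2 = 2 := by
    rw [@norm_sub_sq ℂ, hb.1, hb.1, hb.2 hij]
    norm_num
  rw [dist_eq_norm]
  nlinarith [norm_nonneg (b i - b j)]

/-- The Stinespring space of an operation: vectors `F u x` that depend conjugate linearly on `u`
and linearly on `x`, and whose inner products are the matrix elements of `Φ(|u⟩⟨v|)`. Separability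
of `H` carries over by joint continuity of `F`. -/
lemma IsOperation.exists_stinespring {H : Type u} [NormedAddCommGroup H]
    [InnerProductSpace ℂ H] [CompleteSpace H] [TopologicalSpace.SeparableSpace H]
    {Φ : traceClass H →ₗ[ℂ] traceClass H} (hΦ : IsOperation Φ) :
    ∃ (G : Type u) (_ : NormedAddCommGroup G) (_ : InnerProductSpace ℂ G) (_ : CompleteSpace G)
      (_ : TopologicalSpace.SeparableSpace G) (F : H →L⋆[ℂ] H →L[ℂ] G),
      ∀ u v x y, inner ℂ (F u x) (F v y) = inner ℂ x ((Φ (ketbra u v) : H →L[ℂ] H) y) := by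
  obtain ⟨G, _, _, _, F, hF, hdense⟩ := hΦ.1.exists_gram
  -- The vectors `F u x` are conjugate linear in `u`, as seen from their inner products.
  have hself : ∀ d : G, (∀ v y, inner ℂ d (F v y) = 0) →
      d ∈ Submodule.span ℂ {g | ∃ u x, F u x = g} → d = 0 := fun d hd hmem => by
    have : ∀ g ∈ Submodule.span ℂ {g | ∃ u x, F u x = g}, inner ℂ d g = 0 := fun g hg => by
      induction hg using Submodule.span_induction with
      | mem g hg => obtain ⟨v, y, rfl⟩ := hg; exact hd v y
      | zero => exact inner_zero_right _
      | add g g' _ _ h h' => rw [inner_add_right, h, h', add_zero]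
      | smul c g _ h => rw [inner_smul_right, h, mul_zero]
    exact inner_self_eq_zero.1 (this d hmem)
  have hmem : ∀ u x, F u x ∈ Submodule.span ℂ {g | ∃ u x, F u x = g} := fun u x =>
    Submodule.subset_span ⟨u, x, rfl⟩
  have hadd : ∀ u u' x, F (u + u') x = F u x + F u' x := fun u u' x => by
    refine sub_eq_zero.1 (hself _ (fun v y => ?_)
      (sub_mem (hmem _ _) (add_mem (hmem _ _) (hmem _ _))))
    rw [inner_sub_left, inner_add_left, hF, hF, hF, ketbra_add_left, map_add]
    simp
  have hsmul : ∀ (c : ℂ) u x, F (c • u) x = (starRingEnd ℂ c) • F u x := fun c u x => by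
    refine sub_eq_zero.1 (hself _ (fun v y => ?_)
      (sub_mem (hmem _ _) (Submodule.smul_mem _ _ (hmem _ _))))
    rw [inner_sub_left, inner_smul_left, hF, hF, ketbra_smul_left, map_smul]
    simp
  have hbound : ∀ u x, ‖F u x‖ ≤ 1 * ‖u‖ * ‖x‖ := fun u x => by
    have h1 : ‖(Φ (ketbra u u) : H →L[ℂ] H)‖ ≤ ‖u‖ ^ 2 := by
      have := (enorm_le_etrace (hΦ.1.isPositive (isPositive_ketbra u))).trans
        (hΦ.etrace_le (isPositive_ketbra u))
      rw [etrace_ketbra, ← ofReal_norm, ← ofReal_norm, ← ENNReal.ofReal_pow (norm_nonneg _)] at this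
      exact (ENNReal.ofReal_le_ofReal_iff (by positivity)).1 this
    have h2 : ‖F u x‖ ^ 2 ≤ (‖u‖ * ‖x‖) ^ 2 := by
      have h3 : ‖inner ℂ (F u x) (F u x)‖ = ‖F u x‖ ^ 2 := by
        rw [inner_self_eq_norm_sq_to_K]; simp
      rw [← h3, hF]
      calc ‖inner ℂ x ((Φ (ketbra u u) : H →L[ℂ] H) x)‖
          ≤ ‖x‖ * (‖(Φ (ketbra u u) : H →L[ℂ] H)‖ * ‖x‖) :=
            (norm_inner_le_norm _ _).trans (by gcongr; exact ContinuousLinearMap.le_opNorm _ _)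
        _ ≤ ‖x‖ * (‖u‖ ^ 2 * ‖x‖) := by gcongr
        _ = (‖u‖ * ‖x‖) ^ 2 := by ring
    rw [one_mul]
    exact (pow_le_pow_iff_left₀ (norm_nonneg _) (by positivity) two_ne_zero).1 h2
  let L : H →ₗ⋆[ℂ] H →ₗ[ℂ] G :=
    { toFun := fun u => (F u : H →ₗ[ℂ] G)
      map_add' := fun u u' => LinearMap.ext fun x => hadd u u' x
      map_smul' := fun c u => LinearMap.ext fun x => hsmul c u x }
  let M := L.mkContinuous₂ 1 hbound
  have hcont : Continuous fun p : H × H => M p.1 p.2 :=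
    (M.continuous.comp continuous_fst).clm_apply continuous_snd
  have hsep : TopologicalSpace.SeparableSpace G := by
    rw [← TopologicalSpace.isSeparable_univ_iff]
    have h1 : TopologicalSpace.IsSeparable {g | ∃ u x, F u x = g} := by
      refine (TopologicalSpace.isSeparable_range hcont).mono ?_
      rintro _ ⟨u, x, rfl⟩
      exact ⟨(u, x), rfl⟩
    have h2 := (h1.span (R := ℂ)).closure
    rw [← Submodule.topologicalClosure_coe, hdense] at h2
    exact h2
  exact ⟨G, _, _, inferInstance, hsep, M, hF⟩

lemma exists_adjoint_apply {G : Type*} [NormedAddCommGroup G] [InnerProductSpace ℂ G]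
    [CompleteSpace G] (F : H →L⋆[ℂ] H →L[ℂ] G) (g : G) :
    ∃ K : H →L[ℂ] H, ∀ u, K u = ContinuousLinearMap.adjoint (F u) g := by
  let A : (H →L[ℂ] G) →L⋆[ℂ] (G →L[ℂ] H) :=
    ((ContinuousLinearMap.adjoint : (H →L[ℂ] G) ≃ₗᵢ⋆[ℂ] (G →L[ℂ] H)).toContinuousLinearEquiv :
      (H →L[ℂ] G) →L⋆[ℂ] (G →L[ℂ] H))
  exact ⟨(ContinuousLinearMap.apply ℂ H g).comp (A.comp F), fun u => rfl⟩

/-- Every operation on a separable Hilbert space has a countable Kraus family: evaluation of an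
orthonormal basis `g` of the Stinespring space gives operators `K_j u = (F u)* g_j` with
`Φ(|u⟩⟨v|) = (F u)* (F v) = ∑ j, |K_j u⟩⟨K_j v|`. -/
lemma IsOperation.exists_countable_kraus {H : Type u} [NormedAddCommGroup H]
    [InnerProductSpace ℂ H] [CompleteSpace H] [TopologicalSpace.SeparableSpace H]
    {Φ : traceClass H →ₗ[ℂ] traceClass H} (hΦ : IsOperation Φ) :
    ∃ (ι : Type u) (_ : Countable ι) (K : ι → H →L[ℂ] H), HasWeakKrausSum K Φ := by
  obtain ⟨G, _, _, _, _, F, hF⟩ := hΦ.exists_stinespring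
  obtain ⟨w, b, -⟩ := exists_hilbertBasis ℂ G
  have hw : Countable w := countable_of_orthonormal b.orthonormal
  choose K hKdef using fun j : w => exists_adjoint_apply F (b j)
  have hK : ∀ j u x, inner ℂ x (K j u) = inner ℂ (F u x) (b j) := fun j u x =>
    by rw [hKdef, ContinuousLinearMap.adjoint_inner_right]
  have hK' : ∀ j u x, inner ℂ (K j u) x = inner ℂ (b j) (F u x) := fun j u x => by
    rw [← inner_conj_symm, hK, inner_conj_symm]
  have hsum : ∀ u x y, HasSum (fun j => inner ℂ x ((conj (K j) (ketbra u u) : H →L[ℂ] H) y))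
      (inner ℂ x ((Φ (ketbra u u) : H →L[ℂ] H) y)) := fun u x y => by
    have h := b.hasSum_inner_mul_inner (F u x) (F u y)
    rw [hF] at h
    refine h.congr_fun fun j => ?_
    rw [inner_conj_apply, inner_ketbra, ContinuousLinearMap.star_eq_adjoint,
      ContinuousLinearMap.adjoint_inner_left, ContinuousLinearMap.adjoint_inner_right, hK, hK']
  have hle : ∀ ψ, ∑' j, ‖K j ψ‖ₑ ^ 2 ≤ ‖ψ‖ₑ ^ 2 := fun ψ => by
    have h1 := etrace_eq_tsum (fun j => isPositive_conj (K j) (isPositive_ketbra ψ))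
      fun x => hsum ψ x x
    simp_rw [etrace_conj_ketbra] at h1
    rw [← h1, ← etrace_ketbra]
    exact hΦ.etrace_le (isPositive_ketbra ψ)
  obtain ⟨Ψ, hΨ⟩ := exists_hasWeakKrausSum hle
  refine ⟨w, hw, K, ?_⟩
  have : Φ = Ψ := hΦ.ext (hΨ.isOperation hle) fun u => by
    refine Subtype.ext (ContinuousLinearMap.ext fun y => ext_inner_left ℂ fun x => ?_)
    exact (hsum u x y).unique (hΨ _ x y)
  rwa [this]

/-- Reindexing a Kraus family along an injection, with padding by zeros. -/
lemma HasWeakKrausSum.extend {ι κ : Type*} {K : ι → H →L[ℂ] H}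
    {Φ : traceClass H →ₗ[ℂ] traceClass H} (hΦ : HasWeakKrausSum K Φ) {g : ι → κ}
    (hg : Function.Injective g) : HasWeakKrausSum (Function.extend g K 0) Φ := by
  intro ρ x y
  convert (hasSum_extend_zero hg).2 (hΦ ρ x y) using 1
  funext n
  by_cases h : ∃ j, g j = n
  · obtain ⟨j, rfl⟩ := h
    rw [hg.extend_apply, hg.extend_apply]
  · rw [Function.extend_apply' _ _ _ h, Function.extend_apply' _ _ _ h]
    simp [conj_coe]

/-- Every operation on a separable Hilbert space has a Kraus family indexed by `ℕ`. -/
lemma IsOperation.exists_kraus [TopologicalSpace.SeparableSpace H]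
    {Φ : traceClass H →ₗ[ℂ] traceClass H} (hΦ : IsOperation Φ) :
    ∃ K : ℕ → H →L[ℂ] H, HasWeakKrausSum K Φ := by
  obtain ⟨ι, _, K, hK⟩ := hΦ.exists_countable_kraus
  obtain ⟨g, hg⟩ := exists_injective_nat ι
  exact ⟨_, hK.extend hg⟩

/-! ### Instruments and complete Kraus families -/

lemma HasKrausSum.unique {K : ℕ → H →L[ℂ] H} {J : Set ℕ}
    {Φ Ψ : traceClass H →ₗ[ℂ] traceClass H} (hΦ : HasKrausSum K J Φ) (hΨ : HasKrausSum K J Ψ) :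
    Φ = Ψ :=
  (hasKrausSum_iff.1 hΦ).unique (hasKrausSum_iff.1 hΨ)

lemma HasKrausSum.sum_disjoint {Ω : Type*} {K : ℕ → H →L[ℂ] H} {S : Ω → Set ℕ}
    (hS : Pairwise (Function.onFun Disjoint S)) {I : Ω → traceClass H →ₗ[ℂ] traceClass H}
    (hI : ∀ x, HasKrausSum K (S x) (I x)) (X : Finset Ω) :
    HasKrausSum K (⋃ x ∈ X, S x) (∑ x ∈ X, I x) := by
  rw [hasKrausSum_iff]
  intro ρ φ ψ
  have h := hasSum_sum_disjoint (f := fun n => inner ℂ φ ((conj (K n) ρ : H →L[ℂ] H) ψ)) X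
    (t := S) (a := fun x => inner ℂ φ ((I x ρ : H →L[ℂ] H) ψ)) (fun x _ y _ hxy => hS hxy)
    fun x _ => hasKrausSum_iff.1 (hI x) ρ φ ψ
  have e : inner ℂ φ ((((∑ x ∈ X, I x) ρ : traceClass H) : H →L[ℂ] H) ψ) =
      ∑ x ∈ X, inner ℂ φ ((I x ρ : H →L[ℂ] H) ψ) := by
    rw [LinearMap.sum_apply, AddSubmonoidClass.coe_finsetSum, sum_apply, inner_sum]
  rw [e]
  exact h

lemma HasKrausSum.of_subset {K : ℕ → H →L[ℂ] H} {J J' : Set ℕ}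
    {Φ : traceClass H →ₗ[ℂ] traceClass H} (hΦ : HasKrausSum K J Φ) (hJ : J ⊆ J')
    (hK : ∀ j ∉ J, K j = 0) : HasKrausSum K J' Φ := by
  rw [hasKrausSum_iff] at hΦ ⊢
  intro ρ φ ψ
  have hsupp : Function.support (fun n => inner ℂ φ ((conj (K n) ρ : H →L[ℂ] H) ψ)) ⊆ J := by
    intro n hn
    by_contra hnJ
    exact hn (by simp [hK n hnJ, conj_coe])
  exact (hasSum_subtype_iff_of_support_subset (hsupp.trans hJ)).2
    ((hasSum_subtype_iff_of_support_subset hsupp).1 (hΦ ρ φ ψ))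

lemma HasKrausSum.isComplete {K : ℕ → H →L[ℂ] H} {J : Set ℕ}
    {Λ : traceClass H →ₗ[ℂ] traceClass H} (hΛ : HasKrausSum K J Λ) (h : IsChannel Λ) :
    IsComplete K J := by
  rw [isComplete_iff]
  intro ψ
  rw [(hasKrausSum_iff.1 hΛ).tsum_enorm_sq, h.etrace_eq (isPositive_ketbra ψ), etrace_ketbra]

/-- The Kraus families of the operations of an instrument combine into one complete family, in
which every part of the instrument corresponds to a set of indices. The operators with index
outside the image of the enumeration of `Ω × ℕ` are zero. -/
lemma IsInstrument.exists_kraus [TopologicalSpace.SeparableSpace H] {Ω : Type} [Fintype Ω]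
    {I : Ω → traceClass H →ₗ[ℂ] traceClass H} (hI : IsInstrument I) :
    ∃ K : ℕ → H →L[ℂ] H, IsComplete K Set.univ ∧ HasKrausSum K Set.univ (∑ x, I x) ∧
      ∀ X : Finset Ω, ∃ J : Set ℕ, HasKrausSum K J (∑ x ∈ X, I x) := by
  choose κ hκ using fun x => (hI.1 x).exists_kraus
  obtain ⟨g, hg⟩ := exists_injective_nat (Ω × ℕ)
  let K : ℕ → H →L[ℂ] H := Function.extend g (fun p => κ p.1 p.2) 0
  let S : Ω → Set ℕ := fun x => Set.range fun k => g (x, k)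
  have hS : Pairwise (Function.onFun Disjoint S) := by
    intro x y hxy
    refine Set.disjoint_left.2 ?_
    rintro _ ⟨k, rfl⟩ ⟨l, hl⟩
    exact hxy (congrArg Prod.fst (hg hl)).symm
  have hSI : ∀ x, HasKrausSum K (S x) (I x) := fun x => by
    rw [hasKrausSum_iff]
    intro ρ φ ψ
    have hgx : Function.Injective fun k => g (x, k) := fun k l h => congrArg Prod.snd (hg h)
    refine (hgx.hasSum_range_iff
      (f := fun n => inner ℂ φ ((conj (K n) ρ : H →L[ℂ] H) ψ))).2 ?_
    refine (hκ x ρ φ ψ).congr_fun fun k => ?_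
    simp only [Function.comp_apply, K]
    rw [hg.extend_apply]
  have hX := HasKrausSum.sum_disjoint hS hSI
  have huniv : HasKrausSum K Set.univ (∑ x, I x) := by
    refine (hX Finset.univ).of_subset (Set.subset_univ _) fun n hn => ?_
    refine Function.extend_apply' _ _ _ ?_
    rintro ⟨⟨x, k⟩, rfl⟩
    exact hn (Set.mem_biUnion (Finset.mem_coe.2 (Finset.mem_univ x)) ⟨k, rfl⟩)
  exact ⟨K, huniv.isComplete hI.2, huniv, fun X => ⟨_, hX X⟩⟩

/-- Colouring the indices of a complete Kraus family by a finite set of outcomes gives an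
instrument. -/
lemma IsComplete.exists_instrument {K : ℕ → H →L[ℂ] H} {J : Set ℕ} (hK : IsComplete K J)
    {Ω : Type} [Fintype Ω] (c : ℕ → Ω) :
    ∃ I : Ω → traceClass H →ₗ[ℂ] traceClass H, IsInstrument I ∧
      HasKrausSum K J (∑ x, I x) ∧
      ∀ X : Finset Ω, HasKrausSum K {j ∈ J | c j ∈ X} (∑ x ∈ X, I x) := by
  rw [isComplete_iff] at hK
  let S : Ω → Set ℕ := fun x => {j ∈ J | c j = x}
  have hle : ∀ x ψ, ∑' j : S x, ‖K j ψ‖ₑ ^ 2 ≤ ‖ψ‖ₑ ^ 2 := fun x ψ =>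
    (ENNReal.tsum_mono_subtype (fun j => ‖K j ψ‖ₑ ^ 2) fun j hj => hj.1).trans (hK ψ).le
  choose I hI using fun x => exists_hasWeakKrausSum (K := fun j : S x => K j) (hle x)
  have hS : Pairwise (Function.onFun Disjoint S) := fun x y hxy =>
    Set.disjoint_left.2 fun j hx hy => hxy (hx.2.symm.trans hy.2)
  have hX : ∀ X : Finset Ω, HasKrausSum K {j ∈ J | c j ∈ X} (∑ x ∈ X, I x) := fun X => by
    have h := HasKrausSum.sum_disjoint hS (fun x => hasKrausSum_iff.2 (hI x)) X
    have e : ⋃ x ∈ X, S x = {j ∈ J | c j ∈ X} := by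
      ext j
      simp [S, and_comm]
    rwa [e] at h
  have huniv : HasKrausSum K J (∑ x, I x) := by simpa using hX Finset.univ
  exact ⟨I, ⟨fun x => (hI x).isOperation (hle x),
    (hasKrausSum_iff.1 huniv).isChannel hK⟩, huniv, hX⟩

end QuantumDevice
end

theorem mainTheorem11 {H : Type*} [NormedAddCommGroup H] [InnerProductSpace ℂ H]
    [CompleteSpace H] [TopologicalSpace.SeparableSpace H]
    (Φ₁ Φ₂ : QuantumDevice.traceClass H →ₗ[ℂ] QuantumDevice.traceClass H)
    (hΦ₁ : QuantumDevice.IsOperation Φ₁) (hΦ₂ : QuantumDevice.IsOperation Φ₂) :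
    (QuantumDevice.Compatible Φ₁ Φ₂ ↔
      ∃ (J J₁ J₂ : Set ℕ) (K : ℕ → H →L[ℂ] H), J₁ ⊆ J ∧ J₂ ⊆ J ∧
        QuantumDevice.HasKrausSum K J₁ Φ₁ ∧ QuantumDevice.HasKrausSum K J₂ Φ₂ ∧
        QuantumDevice.IsComplete K J) ∧
    (QuantumDevice.WeaklyCompatible Φ₁ Φ₂ ↔
      ∃ (J J₁ J₂ : Set ℕ) (K L : ℕ → H →L[ℂ] H), J₁ ⊆ J ∧ J₂ ⊆ J ∧
        QuantumDevice.HasKrausSum K J₁ Φ₁ ∧ QuantumDevice.HasKrausSum L J₂ Φ₂ ∧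
        QuantumDevice.IsComplete K J ∧ QuantumDevice.IsComplete L J ∧
        ∃ Λ : QuantumDevice.traceClass H →ₗ[ℂ] QuantumDevice.traceClass H,
          QuantumDevice.HasKrausSum K J Λ ∧ QuantumDevice.HasKrausSum L J Λ) := by
  classical
  refine ⟨⟨?_, ?_⟩, ⟨?_, ?_⟩⟩
  · rintro ⟨Ω, _, I, hI, ⟨X₁, rfl⟩, ⟨X₂, rfl⟩⟩
    obtain ⟨K, hK, -, hX⟩ := hI.exists_kraus
    obtain ⟨J₁, h₁⟩ := hX X₁
    obtain ⟨J₂, h₂⟩ := hX X₂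
    exact ⟨Set.univ, J₁, J₂, K, Set.subset_univ _, Set.subset_univ _, h₁, h₂, hK⟩
  · rintro ⟨J, J₁, J₂, K, hJ₁, hJ₂, h₁, h₂, hK⟩
    -- The outcome of an index records its membership in `J₁` and in `J₂`.
    obtain ⟨I, hI, -, hX⟩ := hK.exists_instrument (Ω := Bool × Bool)
      fun j => (decide (j ∈ J₁), decide (j ∈ J₂))
    refine ⟨Bool × Bool, inferInstance, I, hI, ⟨Finset.univ.filter fun p => p.1 = true, ?_⟩,
      ⟨Finset.univ.filter fun p => p.2 = true, ?_⟩⟩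
    · refine h₁.unique ?_
      convert hX _ using 1
      ext j
      simpa using fun h => hJ₁ h
    · refine h₂.unique ?_
      convert hX _ using 1
      ext j
      simpa using fun h => hJ₂ h
  · rintro ⟨Ω₁, Ω₂, _, _, I₁, I₂, hI₁, hI₂, ⟨X₁, rfl⟩, ⟨X₂, rfl⟩, hΛ⟩
    obtain ⟨K, hK, hKΛ, hX₁⟩ := hI₁.exists_kraus
    obtain ⟨L, hL, hLΛ, hX₂⟩ := hI₂.exists_kraus
    obtain ⟨J₁, h₁⟩ := hX₁ X₁
    obtain ⟨J₂, h₂⟩ := hX₂ X₂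
    exact ⟨Set.univ, J₁, J₂, K, L, Set.subset_univ _, Set.subset_univ _, h₁, h₂, hK, hL,
      ∑ x, I₁ x, hKΛ, hΛ ▸ hLΛ⟩
  · rintro ⟨J, J₁, J₂, K, L, hJ₁, hJ₂, h₁, h₂, hK, hL, Λ, hKΛ, hLΛ⟩
    obtain ⟨I₁, hI₁, hΛ₁, hX₁⟩ := hK.exists_instrument (Ω := Bool) fun j => decide (j ∈ J₁)
    obtain ⟨I₂, hI₂, hΛ₂, hX₂⟩ := hL.exists_instrument (Ω := Bool) fun j => decide (j ∈ J₂)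
    refine ⟨Bool, Bool, inferInstance, inferInstance, I₁, I₂, hI₁, hI₂, ⟨{true}, ?_⟩,
      ⟨{true}, ?_⟩, (hΛ₁.unique hKΛ).trans (hΛ₂.unique hLΛ).symm⟩
    · refine h₁.unique ?_
      convert hX₁ _ using 1
      ext j
      simpa using fun h => hJ₁ h
    · refine h₂.unique ?_
      convert hX₂ _ using 1
      ext j
      simpa using fun h => hJ₂ h
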